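/- **Setting.** Let $(P_t)_{t\ge 0}$ be a (not necessarily symmetric) Markov semigroup of transition kernels on a measurable space $E$ leaving a probability measure $\mu$ invariant and strongly continuous on $L^2(\mu)$. Let $L$ be its generator (on $L^2(\mu)$, extended to $L^1(\mu)$), and for an initial law $\nu$ let $P_t^*\nu$ be the law at time $t$. Assume that there is an algebra $\mathcal A$ of bounded functions, containing the constants, which is a core for $L$ in $L^2(\mu)$, so that the carré du champ $\Gamma(f,g)=L(fg)-fLg-gLf$ is defined, and that $\Gamma$ is a derivation on $\mathcal A$: $\Gamma(fg,k)=f\Gamma(g,k)+g\Gamma(f,k)$. Write $\Gamma(f)=\Gamma(f,f)$ and $$\Gamma_2(f)=\tfrac12\bigl(L\Gamma(f)-2\Gamma(f,Lf)\bigr).$$ The curvature of $L$ is *bounded below by* $\rho$ if $\Gamma_2(f)\ge\rho\,\Gamma(f)$ $\mu$-a.e. for all nice $f$, where the nice functions are a linear space, stable under $P_t$ and a core for $L$, for whose elements $f$ and $Lf$ are in the $L^2(\mu)$-domain of $L$ and $\Gamma(f)$ is in its $L^1(\mu)$-domain. A finite measure $\nu=k\mu$ with bounded density satisfies a *weak Poincaré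 inequality* with the non-increasing function $\beta:(0,\infty)\to[0,\infty)$ if $$\mathrm{Var}_\nu(f)\le\beta(s)\int\Gamma(f)\,d\nu+s\,\mathrm{Osc}(f)^2$$ for all $s>0$ and all bounded $f$ in the $L^2(\mu)$-domain of $L$. Here $\mathrm{Osc}(f)=\sup f-\inf f$ and $\mathrm{Var}_\nu(f)=\int (f-m)^2d\nu$ with $m=\nu(E)^{-1}\int f\,d\nu$. The total variation norm is the total mass, so that $\|h\mu-\mu\|_{TV}=\int|h-1|\,d\mu$. **Theorem.** Assume that the curvature of $L$ is bounded below by $\rho\ge0$. Let $h$ be a probability density with respect to $\mu$ and let $\beta_{WP}$ be a function for which there are functions $h_n$ with $h_n\to(1+h)/2$ in $L^1(\mu)$ such that, for all large $n$, $\tfrac12\le h_n\le n$ and $h_n\mu$ satisfies a weak Poincaré inequality with the function $\beta_{WP}$ (the same for all $n$). 1. For all $t\ge0$, $$\|P_t^*(h\mu)-\mu\|_{TV}\le 2\left(\inf_{s>0}\left\{\frac{\rho\,\beta_{WP}(s)}{e^{\rho t}+\rho\,\beta_{WP}(s)-1}+4s\right\}\right)^{1/2},$$ where for $\rho=0$ the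 fraction is replaced by its limit $\beta_{WP}(s)/(t+\beta_{WP}(s))$ (a quotient $0/0$, possible only if $t=0$ and $\beta_{WP}(s)=0$, is read as $0$). 2. If $\rho>0$ and $s\mapsto\beta_{WP}(s)/s$ is non-increasing for small $s$, put $\theta(u)=\inf\{s>0:\beta_{WP}(s)/s\le 4u/\rho\}$. Then there is a constant $C$, which depends neither on $t$ nor on $h$, such that $\|P_t^*(h\mu)-\mu\|_{TV}\le C\,\theta(e^{\rho t})^{1/2}$ for all $t\ge0$. 3. If $\beta_{WP}(s)\le c\,s^{-q}$ for all $s>0$, with some $q\ge0$, then there is a constant $C$, which depends neither on $t$, on $h$ nor on $\beta_{WP}$ (but may depend on $c$, $q$ and the semigroup), such that $\|P_t^*(h\mu)-\mu\|_{TV}\le C\,e^{-\rho t/(2(1+q))}$ for all $t\ge0$. -/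

import Mathlib

open MeasureTheory ProbabilityTheory Filter Topology Set
open scoped NNReal ENNReal

noncomputable section

/-- A Markov semigroup `(P_t)` of transition kernels on `E` which leaves the measure `μ` invariant
and is strongly continuous on `L²(μ)`. `P t x` is the law at time `t` of the Markov process
started from `x`. -/
structure MarkovSemigroup {E : Type*} [MeasurableSpace E] (μ : Measure E) where
  P : ℝ≥0 → Kernel E E
  isMarkov : ∀ t, IsMarkovKernel (P t)
  zero : P 0 = Kernel.id
  add : ∀ s t, P (s + t) = P t ∘ₖ P s
  invariant : ∀ t, μ.bind (P t) = μ
  continuous : ∀ f : E → ℝ, MemLp f 2 μ →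
    Tendsto (fun t : ℝ≥0 => eLpNorm (fun x => (∫ y, f y ∂(P t x)) - f x) 2 μ) (𝓝[>] 0) (𝓝 0)

namespace MarkovSemigroup

variable {E : Type*} [MeasurableSpace E] {μ : Measure E} (S : MarkovSemigroup μ)

/-- The function `P_t f`. -/
def act (t : ℝ≥0) (f : E → ℝ) (x : E) : ℝ := ∫ y, f y ∂(S.P t x)

/-- `P_t^* ν`, the law at time `t` of the process with initial law `ν`. -/
def law (t : ℝ≥0) (ν : Measure E) : Measure E := ν.bind (S.P t)

/-- `g = L f`, where `L` is the infinitesimal generator of `(P_t)` on `L^p(μ)`: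
`(P_t f - f) / t → g` in `L^p(μ)` as `t → 0+`. -/
def HasGen (p : ℝ≥0∞) (f g : E → ℝ) : Prop :=
  MemLp f p μ ∧ MemLp g p μ ∧
    Tendsto (fun t : ℝ≥0 => eLpNorm (fun x => (t : ℝ)⁻¹ * (S.act t f x - f x) - g x) p μ)
      (𝓝[>] 0) (𝓝 0)

/-- `f` belongs to the domain of the generator on `L^p(μ)`. -/
def Dom (p : ℝ≥0∞) (f : E → ℝ) : Prop := ∃ g, S.HasGen p f g

open Classical in
/-- `L f`, the generator on `L^p(μ)` applied to `f` in its domain (determined up to a `μ`-null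
set; every use below is insensitive to the choice of the version). -/
def gen (p : ℝ≥0∞) (f : E → ℝ) : E → ℝ := if hf : S.Dom p f then hf.choose else 0

/-- The carré du champ `Γ(f, g) = L(fg) - f Lg - g Lf`. For `f`, `g` in the `L²(μ)`-domain the
product `fg` is only in `L¹(μ)`, so `L(fg)` is taken with the generator on `L¹(μ)`, which extends
the one on `L²(μ)`. -/
def gamma (f g : E → ℝ) : E → ℝ := fun x =>
  S.gen 1 (fun y => f y * g y) x - f x * S.gen 2 g x - g x * S.gen 2 f x

/-- `Γ₂(f, g) = (1/2) (L Γ(f, g) - Γ(L f, g) - Γ(f, L g))`. -/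
def gamma2 (f g : E → ℝ) : E → ℝ := fun x =>
  (1 / 2) * (S.gen 1 (S.gamma f g) x - S.gamma (S.gen 2 f) g x - S.gamma f (S.gen 2 g) x)

/-- `A` is a core for the generator on `L²(μ)`: a set of functions in its domain that is dense
in the domain for the graph norm. -/
def IsCore (A : Set (E → ℝ)) : Prop :=
  (∀ f ∈ A, S.Dom 2 f) ∧
  ∀ f, S.Dom 2 f → ∀ ε : ℝ, 0 < ε → ∃ g ∈ A,
    eLpNorm (fun x => f x - g x) 2 μ < ENNReal.ofReal ε ∧
    eLpNorm (fun x => S.gen 2 f x - S.gen 2 g x) 2 μ < ENNReal.ofReal ε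

/-- The standing framework: `A` is an algebra of bounded measurable functions containing the
constants, it is a core for the generator (in particular `L` is defined on products of elements
of `A`, so that there is a carré du champ), and `Γ` is a derivation on `A`. -/
structure IsDiffusionAlgebra (A : Subalgebra ℝ (E → ℝ)) : Prop where
  measurable : ∀ f ∈ A, Measurable f
  bounded : ∀ f ∈ A, ∃ C : ℝ, ∀ x, |f x| ≤ C
  core : S.IsCore (A : Set (E → ℝ))
  derivation : ∀ f ∈ A, ∀ g ∈ A, ∀ k ∈ A,
    ∀ᵐ x ∂μ, S.gamma (f * g) k x = f x * S.gamma g k x + g x * S.gamma f k x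

/-- The curvature of `L` is bounded from below by `ρ`: `Γ₂(f) ≥ ρ Γ(f)` for all nice `f`. The nice
functions are a linear space `N`, stable under the semigroup and forming a core, all of whose
elements are regular enough for the terms `Γ(f)`, `Γ(f, L f)` and `L Γ(f)` to be defined. -/
def CurvatureBoundedBelow (ρ : ℝ) : Prop :=
  ∃ N : Submodule ℝ (E → ℝ),
    (∀ t, ∀ f ∈ N, S.act t f ∈ N) ∧
    S.IsCore (N : Set (E → ℝ)) ∧
    ∀ f ∈ N, S.Dom 2 (S.gen 2 f) ∧ S.Dom 1 (S.gamma f f) ∧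
      ∀ᵐ x ∂μ, ρ * S.gamma f f x ≤ S.gamma2 f f x

/-- The measure `h μ`. -/
def _root_.densityMeasure (μ : Measure E) (h : E → ℝ) : Measure E :=
  μ.withDensity fun x => ENNReal.ofReal (h x)

/-- The variance of `f` under a finite measure `ν` (the usual variance if `ν` is a
probability measure; `⨍` is the mean value). -/
def _root_.varOf (ν : Measure E) (f : E → ℝ) : ℝ := ∫ x, (f x - ⨍ y, f y ∂ν) ^ 2 ∂ν

/-- The oscillation `sup f - inf f` of a bounded function. -/
def _root_.osc (f : E → ℝ) : ℝ := (⨆ x, f x) - ⨅ x, f x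

/-- `ν` satisfies a weak Poincaré inequality with the non-increasing function `β` on `(0, ∞)`:
`Var_ν(f) ≤ β(s) ∫ Γ(f) dν + s Osc²(f)` for all `s > 0` and all bounded `f` in the
`L²(μ)`-domain of `L`. -/
def WeakPoincare (ν : Measure E) (β : ℝ → ℝ) : Prop :=
  AntitoneOn β (Ioi 0) ∧ (∀ s, 0 < s → 0 ≤ β s) ∧
  ∀ s, 0 < s → ∀ f : E → ℝ, Measurable f → (∃ C : ℝ, ∀ x, |f x| ≤ C) → S.Dom 2 f →
    varOf ν f ≤ β s * ∫ x, S.gamma f f x ∂ν + s * osc f ^ 2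

/-- `h` is a density of probability with respect to `μ`. -/
def _root_.IsProbDensity (μ : Measure E) (h : E → ℝ) : Prop :=
  Measurable h ∧ (∀ᵐ x ∂μ, 0 ≤ h x) ∧ Integrable h μ ∧ ∫ x, h x ∂μ = 1

/-- `(1 + h) / 2` is the limit in `L¹(μ)` of functions `h_n` with `1/2 ≤ h_n ≤ n` such that
every `h_n μ` satisfies a weak Poincaré inequality with the same function `β`. The sequence may
start at any index; the masses of the `h_n μ` need not be exactly one. -/
def WeakPoincareApprox (β : ℝ → ℝ) (h : E → ℝ) : Prop :=
  ∃ hn : ℕ → E → ℝ, (∀ n, Measurable (hn n)) ∧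
    (∀ᶠ n : ℕ in atTop, (∀ᵐ x ∂μ, 1 / 2 ≤ hn n x ∧ hn n x ≤ n) ∧
      S.WeakPoincare (densityMeasure μ (hn n)) β) ∧
    Tendsto (fun n => eLpNorm (fun x => hn n x - (1 + h x) / 2) 1 μ) atTop (𝓝 0)

end MarkovSemigroup

/-- The total variation distance `‖ν - μ‖_TV` of two probability measures, normalised as the total
mass of `|ν - μ|`, i.e. as `∫ |h - 1| dμ` when `ν = h μ`. -/
def tvDist {E : Type*} [MeasurableSpace E] (ν μ : Measure E) : ℝ :=
  2 * ⨆ B : {B : Set E // MeasurableSet B}, |ν.real B - μ.real B|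

/-- The quantity `ρ b / (e^{ρ t} + ρ b - 1)`, replaced for `ρ = 0` by its limit `b / (t + b)`. -/
def curvRate (ρ t b : ℝ) : ℝ :=
  if ρ = 0 then b / (t + b) else ρ * b / (Real.exp (ρ * t) + ρ * b - 1)

/-- `θ(u) = inf {s > 0 : β(s) / s ≤ 4 u / ρ}`. -/
def thetaWP (β : ℝ → ℝ) (ρ u : ℝ) : ℝ := sInf {s : ℝ | 0 < s ∧ β s / s ≤ 4 * u / ρ}

end

/-! The core is a reverse local Poincaré inequality, which needs no symmetry. Fix `t` and
interpolate by `ψ(s) = P_s((P_{t-s} f)²)`. Then `ψ' = φ` with `φ(s) = P_s Γ(P_{t-s} f)`, and `φ' = 2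
P_s Γ₂(P_{t-s} f) ≥ ρ φ`, so that `φ(s) ≥ e^{ρ s} φ(0)`. With `c = ∫₀ᵗ e^{ρ s} ds` (`curvTime`),
integration gives `c Γ(P_t f) ≤ P_t(f²) - (P_t f)²`. Hence if `|f| ≤ 1` and `k` is a bounded density
of mass `m`, then `c ∫ Γ(P_t f) k dμ ≤ m - ∫ (P_t f)² k dμ`.

The weak Poincaré inequality of `k μ`, applied to `P_t f`, now bounds a variance by an energy that
the variance itself controls. Eliminating the energy, and letting `k = h_n` tend to `(1 + h) / 2`,
gives `Var(P_t f) ≤ β(s) / (c + β(s)) + 4 s` (`WeakPoincareApprox.variance_act_le`). The law at time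
`t` is compared with `μ` by duality: `∫ (h - 1) P_t f dμ` can be centred because `h - 1` has mean
zero, and `|h - 1| ≤ 1 + h`, so Cauchy-Schwarz bounds it by twice the standard deviation of `P_t f`
under `((1 + h) / 2) μ` (`sq_integral_mul_sub_one_le`). The last two estimates follow by choosing
`s`.

The analytic work is in making the interpolation legitimate. `Γ` is given through `L(fg)`, which is
known to exist only for `f`, `g` in the algebra. It is the limit of `(P_t(fg) - P_t f P_t g) / t`;
these bilinear forms are positive, and invariance of `μ` bounds them uniformly in `t` by the graph
norm of `L`. So the limit exists on the whole domain and is continuous into `L¹(μ)`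
(`IsDiffusionAlgebra.exists_carreDuChamp`). The reverse inequality is then proved for nice
functions, tested against a positive functional on `L¹(μ)`, and passes to the domain because the
nice functions form a core. -/

/-! ### Contraction semigroups on a Banach space. -/

/-- A strongly continuous semigroup of linear contractions of a Banach space. -/
structure ContractionSemigroup (X : Type*) [NormedAddCommGroup X] [NormedSpace ℝ X] where
  T : ℝ≥0 → X →L[ℝ] X
  norm_le : ∀ t x, ‖T t x‖ ≤ ‖x‖
  zero : ∀ x, T 0 x = x
  add : ∀ s t x, T (s + t) x = T s (T t x)
  tendsto_zero : ∀ x, Tendsto (fun t => T t x) (𝓝[>] 0) (𝓝 x)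

namespace ContractionSemigroup

variable {X : Type*} [NormedAddCommGroup X] [NormedSpace ℝ X] (T : ContractionSemigroup X)

/-- `y = A x`, where `A` is the generator of the semigroup. -/
def Gen (x y : X) : Prop :=
  Tendsto (fun t : ℝ≥0 => (t : ℝ)⁻¹ • (T.T t x - x)) (𝓝[>] 0) (𝓝 y)

variable {T}

theorem Gen.unique {x y z : X} (h : T.Gen x y) (h' : T.Gen x z) : y = z :=
  tendsto_nhds_unique h h'

theorem Gen.add {x y x' y' : X} (h : T.Gen x y) (h' : T.Gen x' y') :
    T.Gen (x + x') (y + y') := by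
  refine (Tendsto.add h h').congr fun t => ?_
  rw [map_add, ← smul_add]
  congr 1
  abel

theorem Gen.smul {x y : X} (c : ℝ) (h : T.Gen x y) : T.Gen (c • x) (c • y) := by
  refine (Tendsto.const_smul h c).congr fun t => ?_
  rw [map_smul, smul_comm, smul_sub c]

theorem Gen.zero : T.Gen 0 0 := by
  refine tendsto_const_nhds.congr fun t => ?_
  simp

theorem commute (s t : ℝ≥0) (x : X) : T.T s (T.T t x) = T.T t (T.T s x) := by
  rw [← T.add, ← T.add, add_comm]

theorem Gen.apply {x y : X} (h : T.Gen x y) (s : ℝ≥0) : T.Gen (T.T s x) (T.T s y) := by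
  refine (((T.T s).continuous.tendsto y).comp h).congr fun t => ?_
  simp [commute t s]

variable (T)

/-- Factor out the operator of the smaller time. In `ℝ≥0` one of the two truncated differences
vanishes, so their sum is `|t - s|`. -/
theorem norm_sub_le (s t : ℝ≥0) (x : X) :
    ‖T.T t x - T.T s x‖ ≤ ‖T.T (t - s + (s - t)) x - x‖ := by
  have key : ∀ a b : ℝ≥0, a ≤ b → ‖T.T b x - T.T a x‖ ≤ ‖T.T (b - a) x - x‖ := by
    intro a b hab
    have : T.T b x - T.T a x = T.T a (T.T (b - a) x - x) := by
      rw [map_sub, ← T.add, add_tsub_cancel_of_le hab]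
    rw [this]
    exact T.norm_le _ _
  rcases le_total s t with h | h
  · rw [tsub_eq_zero_of_le h, add_zero]
    exact key s t h
  · rw [tsub_eq_zero_of_le h, zero_add, norm_sub_rev]
    exact key t s h

theorem tendsto_nhds_zero (x : X) : Tendsto (fun t => T.T t x) (𝓝 0) (𝓝 x) := by
  have h : ContinuousWithinAt (fun t => T.T t x) (Ioi 0) 0 := by
    have := T.tendsto_zero x
    rwa [ContinuousWithinAt, T.zero]
  have h' : ContinuousWithinAt (fun t => T.T t x) (Ici 0) 0 := by
    rw [← Ioi_insert]
    exact h.insert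
  have h3 : ContinuousAt (fun t => T.T t x) 0 := by
    rw [← continuousWithinAt_univ]
    refine h'.mono fun y _ => mem_Ici.2 zero_le
  have := h3.tendsto
  rwa [T.zero] at this

theorem continuous_orbit (x : X) : Continuous fun t => T.T t x := by
  rw [continuous_iff_continuousAt]
  intro s
  rw [ContinuousAt, tendsto_iff_norm_sub_tendsto_zero]
  have h1 : Tendsto (fun t : ℝ≥0 => t - s + (s - t)) (𝓝 s) (𝓝 0) := by
    have : Continuous fun t : ℝ≥0 => t - s + (s - t) := by fun_prop
    simpa using this.tendsto s
  have h2 := (tendsto_iff_norm_sub_tendsto_zero.1 (T.tendsto_nhds_zero x)).comp h1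
  exact squeeze_zero (fun _ => norm_nonneg _) (fun t => T.norm_sub_le s t x) h2

theorem tendsto_apply {ι : Type*} {l : Filter ι} {r : ι → ℝ≥0} {s : ℝ≥0} {z : ι → X} {y : X}
    (hr : Tendsto r l (𝓝 s)) (hz : Tendsto z l (𝓝 y)) :
    Tendsto (fun i => T.T (r i) (z i)) l (𝓝 (T.T s y)) := by
  have h1 := ((T.continuous_orbit y).tendsto s).comp hr
  rw [tendsto_iff_norm_sub_tendsto_zero] at h1 hz ⊢
  refine squeeze_zero (fun _ => norm_nonneg _) (fun i => ?_) (by simpa using hz.add h1)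
  calc ‖T.T (r i) (z i) - T.T s y‖
      = ‖T.T (r i) (z i - y) + (T.T (r i) y - T.T s y)‖ := by rw [map_sub]; congr 1; abel
    _ ≤ _ := (norm_add_le _ _).trans (by gcongr; exact T.norm_le _ _)

variable {T}

/-- The product rule for `r ↦ T_r (G r)`, from the right. -/
theorem hasDerivWithinAt_apply {G : ℝ → X} {G' y : X} {s : ℝ} (hs : 0 ≤ s)
    (hG : HasDerivWithinAt G G' (Ici s) s) (hy : T.Gen (G s) y) :
    HasDerivWithinAt (fun r => T.T r.toNNReal (G r)) (T.T s.toNNReal (y + G')) (Ici s) s := by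
  rw [← hasDerivWithinAt_Ioi_iff_Ici, hasDerivWithinAt_iff_tendsto_slope' self_notMem_Ioi] at hG ⊢
  have h0 : Tendsto (fun r : ℝ => (r - s).toNNReal) (𝓝[>] s) (𝓝[>] 0) := by
    refine tendsto_nhdsWithin_iff.2 ⟨?_, ?_⟩
    · have : Continuous fun r : ℝ => (r - s).toNNReal := by fun_prop
      have h2 := this.tendsto s
      simp only [sub_self, Real.toNNReal_zero] at h2
      exact h2.mono_left nhdsWithin_le_nhds
    · filter_upwards [self_mem_nhdsWithin] with r hr
      simpa using hr
  have h1 : Tendsto (fun r : ℝ => r.toNNReal) (𝓝[>] s) (𝓝 s.toNNReal) :=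
    (continuous_real_toNNReal.tendsto s).mono_left nhdsWithin_le_nhds
  have h2 := T.tendsto_apply h1 hG
  have h3 := ((T.T s.toNNReal).continuous.tendsto y).comp (Tendsto.comp hy h0)
  rw [map_add]
  refine (h3.add h2).congr' ?_
  filter_upwards [self_mem_nhdsWithin] with r hr
  have hr' : s < r := hr
  have e : r.toNNReal = s.toNNReal + (r - s).toNNReal := by
    rw [← Real.toNNReal_add hs (by linarith)]
    congr 1
    ring
  simp only [Function.comp, slope, vsub_eq_sub, map_smul, map_sub]
  rw [Real.coe_toNNReal _ (by linarith), ← smul_add, ← T.add, ← e]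
  congr 1
  abel

theorem Gen.hasDerivWithinAt_Ici {x y : X} (h : T.Gen x y) {s : ℝ} (hs : 0 ≤ s) :
    HasDerivWithinAt (fun r : ℝ => T.T r.toNNReal x) (T.T s.toNNReal y) (Ici s) s := by
  have := hasDerivWithinAt_apply hs (hasDerivWithinAt_const s (Ici s) x) h
  simpa using this

variable (T) in
theorem continuous_orbit_real (x : X) : Continuous fun r : ℝ => T.T r.toNNReal x :=
  (T.continuous_orbit x).comp continuous_real_toNNReal

variable [CompleteSpace X]

theorem Gen.integral_eq {x y : X} (h : T.Gen x y) {t : ℝ} (ht : 0 ≤ t) :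
    ∫ s in (0 : ℝ)..t, T.T s.toNNReal y = T.T t.toNNReal x - x := by
  have := intervalIntegral.integral_eq_sub_of_hasDeriv_right
    (f := fun r : ℝ => T.T r.toNNReal x) (f' := fun r : ℝ => T.T r.toNNReal y) (a := 0) (b := t)
    (T.continuous_orbit_real x).continuousOn
    (fun s hs => (h.hasDerivWithinAt_Ici (by
      rw [min_eq_left ht] at hs; exact hs.1.le)).mono Ioi_subset_Ici_self)
    ((T.continuous_orbit_real y).intervalIntegrable _ _)
  rw [this]
  simp [T.zero]

/-- The generator only controls right derivatives. The left one comes from the integral formula for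
the orbit, whose integrand is continuous. It is needed because the interpolation runs the orbit
backwards in time. -/
theorem Gen.hasDerivAt {x y : X} (h : T.Gen x y) {s : ℝ} (hs : 0 < s) :
    HasDerivAt (fun r : ℝ => T.T r.toNNReal x) (T.T s.toNNReal y) s := by
  have h1 : HasDerivAt (fun t : ℝ => ∫ s in (0 : ℝ)..t, T.T s.toNNReal y) (T.T s.toNNReal y) s :=
    (T.continuous_orbit_real y).integral_hasStrictDerivAt 0 s |>.hasDerivAt
  refine (h1.add_const x).congr_of_eventuallyEq ?_
  filter_upwards [lt_mem_nhds hs] with t ht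
  rw [h.integral_eq ht.le]
  abel

theorem Gen.norm_sub_le {x y : X} (h : T.Gen x y) (t : ℝ≥0) : ‖T.T t x - x‖ ≤ t * ‖y‖ := by
  have h1 := h.integral_eq t.coe_nonneg
  rw [Real.toNNReal_coe] at h1
  rw [← h1]
  have := intervalIntegral.norm_integral_le_of_norm_le_const (a := (0 : ℝ)) (b := t)
    (f := fun s : ℝ => T.T s.toNNReal y) (C := ‖y‖) (fun s _ => T.norm_le _ _)
  simpa [abs_of_nonneg t.coe_nonneg, mul_comm] using this

/-- Time averages of an orbit lie in the domain of the generator. -/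
theorem gen_integral (x : X) {e : ℝ} (he : 0 ≤ e) :
    T.Gen (∫ s in (0 : ℝ)..e, T.T s.toNNReal x) (T.T e.toNNReal x - x) := by
  have hc := T.continuous_orbit_real x
  have hi : ∀ a b, IntervalIntegrable (fun r : ℝ => T.T r.toNNReal x) volume a b :=
    fun a b => hc.intervalIntegrable a b
  -- Shifting the window `[0, e]` by `t` adds the integral over `[e, e + t]` and removes the one
  -- over `[0, t]`.
  have key : ∀ t : ℝ≥0, T.T t (∫ s in (0 : ℝ)..e, T.T s.toNNReal x)
      - ∫ s in (0 : ℝ)..e, T.T s.toNNReal x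
      = (∫ s in (0 : ℝ)..(e + t), T.T s.toNNReal x) - (∫ s in (0 : ℝ)..e, T.T s.toNNReal x)
        - ((∫ s in (0 : ℝ)..(0 + t), T.T s.toNNReal x)
          - ∫ s in (0 : ℝ)..0, T.T s.toNNReal x) := by
    intro t
    have h1 : T.T t (∫ s in (0 : ℝ)..e, T.T s.toNNReal x)
        = ∫ s in (0 : ℝ)..e, T.T (s + t).toNNReal x := by
      rw [← ContinuousLinearMap.intervalIntegral_comp_comm _ (hi _ _)]
      refine intervalIntegral.integral_congr fun s hs => ?_
      rw [uIcc_of_le he] at hs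
      change T.T t (T.T s.toNNReal x) = T.T (s + t).toNNReal x
      rw [Real.toNNReal_add hs.1 t.coe_nonneg, Real.toNNReal_coe, add_comm, T.add]
    rw [h1, intervalIntegral.integral_comp_add_right (fun s => T.T s.toNNReal x)]
    rw [intervalIntegral.integral_same, sub_zero, intervalIntegral.integral_interval_sub_left
      (hi _ _) (hi _ _), ← intervalIntegral.integral_interval_sub_left (hi 0 (e + t)) (hi 0 (0 + t)),
      ← intervalIntegral.integral_interval_sub_left (hi 0 (e + t)) (hi 0 e)]
    abel
  have hd : ∀ a : ℝ, Tendsto (fun t : ℝ≥0 => (t : ℝ)⁻¹ •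
      ((∫ s in (0 : ℝ)..(a + t), T.T s.toNNReal x) - ∫ s in (0 : ℝ)..a, T.T s.toNNReal x))
      (𝓝[>] 0) (𝓝 (T.T a.toNNReal x)) := by
    intro a
    have h1 : HasDerivAt (fun t : ℝ => ∫ s in (0 : ℝ)..t, T.T s.toNNReal x) (T.T a.toNNReal x) a :=
      (hc.integral_hasStrictDerivAt 0 a).hasDerivAt
    have h2 := hasDerivAt_iff_tendsto_slope_zero.1 h1
    have h3 : Tendsto (fun t : ℝ≥0 => (t : ℝ)) (𝓝[>] 0) (𝓝[≠] 0) := by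
      refine tendsto_nhdsWithin_iff.2 ⟨?_, ?_⟩
      · exact (NNReal.continuous_coe.tendsto 0).mono_left nhdsWithin_le_nhds
      · filter_upwards [self_mem_nhdsWithin] with r hr
        simpa using (ne_of_gt hr)
    exact h2.comp h3
  have h := (hd e).sub (hd 0)
  rw [Real.toNNReal_zero, T.zero] at h
  refine Tendsto.congr (fun t => ?_) h
  rw [key, ← smul_sub]

theorem tendsto_average (x : X) :
    Tendsto (fun e : ℝ => e⁻¹ • ∫ s in (0 : ℝ)..e, T.T s.toNNReal x) (𝓝[>] 0) (𝓝 x) := by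
  have h1 : HasDerivAt (fun t : ℝ => ∫ s in (0 : ℝ)..t, T.T s.toNNReal x)
      (T.T (0 : ℝ).toNNReal x) 0 :=
    ((T.continuous_orbit_real x).integral_hasStrictDerivAt 0 0).hasDerivAt
  rw [Real.toNNReal_zero, T.zero] at h1
  have h2 := (hasDerivAt_iff_tendsto_slope_zero.1 h1).mono_left
    (nhdsWithin_mono 0 (fun r (hr : (0 : ℝ) < r) => hr.ne'))
  refine h2.congr fun t => ?_
  simp

end ContractionSemigroup

/-! ### The Markov semigroup as contraction semigroups on `L²(μ)` and `L¹(μ)`. -/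

noncomputable section

namespace MarkovSemigroup

variable {E : Type*} [MeasurableSpace E] {μ : Measure E} (S : MarkovSemigroup μ)

instance (t : ℝ≥0) : IsMarkovKernel (S.P t) := S.isMarkov t

theorem ae_ae_kernel (t : ℝ≥0) {q : E → Prop} (h : ∀ᵐ y ∂μ, q y) :
    ∀ᵐ x ∂μ, ∀ᵐ y ∂(S.P t x), q y := by
  refine Measure.ae_ae_of_ae_comp ?_
  rwa [S.invariant t]

theorem act_congr (t : ℝ≥0) {f g : E → ℝ} (h : f =ᵐ[μ] g) : S.act t f =ᵐ[μ] S.act t g := by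
  filter_upwards [S.ae_ae_kernel t h] with x hx
  exact integral_congr_ae hx

theorem ae_integrable (t : ℝ≥0) {f : E → ℝ} (hf : Integrable f μ) :
    ∀ᵐ x ∂μ, Integrable f (S.P t x) := by
  refine Measure.ae_integrable_of_integrable_comp ?_
  rwa [S.invariant t]

theorem measurable_act (t : ℝ≥0) {f : E → ℝ} (hf : Measurable f) : Measurable (S.act t f) :=
  (hf.stronglyMeasurable.integral_kernel (κ := S.P t)).measurable

theorem aestronglyMeasurable_act (t : ℝ≥0) {f : E → ℝ} (hf : AEStronglyMeasurable f μ) :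
    AEStronglyMeasurable (S.act t f) μ :=
  (S.measurable_act t hf.stronglyMeasurable_mk.measurable).aestronglyMeasurable.congr
    (S.act_congr t hf.ae_eq_mk.symm)

theorem integral_act (t : ℝ≥0) {f : E → ℝ} (hf : Integrable f μ) :
    ∫ x, S.act t f x ∂μ = ∫ x, f x ∂μ := by
  have h : (S.P t ∘ₖ Kernel.const Unit μ) () = μ := by
    rw [← Measure.comp_eq_comp_const_apply, S.invariant t]
  have := ProbabilityTheory.Kernel.integral_comp (κ := Kernel.const Unit μ) (η := S.P t) (a := ())
    (f := f) (by rwa [h])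
  rw [h] at this
  rw [this]
  rfl

theorem act_add_ae (t : ℝ≥0) {f g : E → ℝ} (hf : Integrable f μ) (hg : Integrable g μ) :
    S.act t (f + g) =ᵐ[μ] S.act t f + S.act t g := by
  filter_upwards [S.ae_integrable t hf, S.ae_integrable t hg] with x h1 h2
  exact integral_add h1 h2

theorem act_smul (t : ℝ≥0) (c : ℝ) (f : E → ℝ) : S.act t (c • f) = c • S.act t f := by
  ext x
  exact integral_const_mul c f

theorem act_semigroup_ae (s t : ℝ≥0) {f : E → ℝ} (hf : Integrable f μ) :
    S.act (s + t) f =ᵐ[μ] S.act s (S.act t f) := by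
  filter_upwards [S.ae_integrable (s + t) hf] with x hx
  rw [S.add] at hx
  have := ProbabilityTheory.Kernel.integral_comp hx
  rw [act, S.add, this]
  rfl

theorem act_zero {f : E → ℝ} (hf : AEStronglyMeasurable f μ) : S.act 0 f =ᵐ[μ] f := by
  have h1 := S.act_congr 0 hf.ae_eq_mk
  refine (h1.trans ?_).trans hf.ae_eq_mk.symm
  refine Eventually.of_forall fun x => ?_
  rw [act, S.zero, Kernel.id_apply, integral_dirac' _ _ hf.stronglyMeasurable_mk]

/-- Jensen's inequality for the probability measure `P_t(x, ·)`, integrated over `x` by invariance.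
-/
theorem eLpNorm_act_le (t : ℝ≥0) {p : ℝ≥0∞} (hp : 1 ≤ p) (hp' : p ≠ ∞) {f : E → ℝ}
    (hf : AEStronglyMeasurable f μ) : eLpNorm (S.act t f) p μ ≤ eLpNorm f p μ := by
  have hp0 : p ≠ 0 := (zero_lt_one.trans_le hp).ne'
  have hpos : 0 < p.toReal := ENNReal.toReal_pos hp0 hp'
  have hpt : ∀ᵐ x ∂μ, ‖S.act t f x‖ₑ ^ p.toReal ≤ ∫⁻ y, ‖f y‖ₑ ^ p.toReal ∂(S.P t x) := by
    filter_upwards [S.ae_ae_kernel t hf.ae_eq_mk] with x hx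
    have hm : AEStronglyMeasurable f (S.P t x) := ⟨_, hf.stronglyMeasurable_mk, hx⟩
    have h1 : ‖S.act t f x‖ₑ ≤ eLpNorm f p (S.P t x) := by
      refine (enorm_integral_le_lintegral_enorm f).trans ?_
      rw [← eLpNorm_one_eq_lintegral_enorm]
      exact eLpNorm_le_eLpNorm_of_exponent_le hp hm
    calc ‖S.act t f x‖ₑ ^ p.toReal ≤ eLpNorm f p (S.P t x) ^ p.toReal := by gcongr
      _ = _ := by
        rw [eLpNorm_eq_lintegral_rpow_enorm_toReal hp0 hp', ← ENNReal.rpow_mul,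
          one_div, inv_mul_cancel₀ hpos.ne', ENNReal.rpow_one]
  rw [eLpNorm_eq_lintegral_rpow_enorm_toReal hp0 hp', eLpNorm_eq_lintegral_rpow_enorm_toReal hp0 hp']
  refine ENNReal.rpow_le_rpow ?_ (by positivity)
  refine (lintegral_mono_ae hpt).trans (le_of_eq ?_)
  rw [← Measure.lintegral_bind (S.P t).measurable.aemeasurable, S.invariant t]
  rw [S.invariant t]
  exact hf.enorm.pow_const _

theorem memLp_act (t : ℝ≥0) {p : ℝ≥0∞} (hp : 1 ≤ p) (hp' : p ≠ ∞) {f : E → ℝ}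
    (hf : MemLp f p μ) : MemLp (S.act t f) p μ :=
  ⟨S.aestronglyMeasurable_act t hf.1, (S.eLpNorm_act_le t hp hp' hf.1).trans_lt hf.2⟩

theorem hasGen_gen {p : ℝ≥0∞} {f : E → ℝ} (hf : S.Dom p f) : S.HasGen p f (S.gen p f) := by
  rw [gen, dif_pos hf]
  exact hf.choose_spec

theorem hasGen_congr {p : ℝ≥0∞} {f f' g g' : E → ℝ} (h : S.HasGen p f g) (hf : f =ᵐ[μ] f')
    (hg : g =ᵐ[μ] g') : S.HasGen p f' g' := by
  refine ⟨h.1.ae_eq hf, h.2.1.ae_eq hg, h.2.2.congr fun t => eLpNorm_congr_ae ?_⟩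
  filter_upwards [hf, hg, S.act_congr t hf] with x h1 h2 h3
  rw [h1, h2, h3]

variable [IsProbabilityMeasure μ]

/-- The operator `P_t` on `L^p(μ)`, as a linear map. -/
def lpActₗ (p : ℝ≥0∞) [hp : Fact (1 ≤ p)] (hp' : p ≠ ∞) (t : ℝ≥0) :
    Lp ℝ p μ →ₗ[ℝ] Lp ℝ p μ where
  toFun f := (S.memLp_act t hp.out hp' (Lp.memLp f)).toLp (S.act t f)
  map_add' f g := by
    rw [← MemLp.toLp_add]
    refine MemLp.toLp_congr _ _ ?_
    exact (S.act_congr t (Lp.coeFn_add f g)).trans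
      (S.act_add_ae t ((Lp.memLp f).integrable hp.out) ((Lp.memLp g).integrable hp.out))
  map_smul' c f := by
    rw [RingHom.id_apply, ← MemLp.toLp_const_smul]
    refine MemLp.toLp_congr _ _ ?_
    refine (S.act_congr t (Lp.coeFn_smul c f)).trans ?_
    rw [S.act_smul]

/-- The operator `P_t` on `L^p(μ)`. -/
def lpAct (p : ℝ≥0∞) [hp : Fact (1 ≤ p)] (hp' : p ≠ ∞) (t : ℝ≥0) : Lp ℝ p μ →L[ℝ] Lp ℝ p μ :=
  (S.lpActₗ p hp' t).mkContinuous 1 fun f => by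
    rw [one_mul, lpActₗ]
    refine (Lp.norm_toLp (S.act t f) (S.memLp_act t hp.out hp' (Lp.memLp f))).trans_le ?_
    rw [Lp.norm_def]
    exact ENNReal.toReal_mono (Lp.eLpNorm_ne_top f) (S.eLpNorm_act_le t hp.out hp' (Lp.memLp f).1)

variable {p : ℝ≥0∞} [hp : Fact (1 ≤ p)] (hp' : p ≠ ∞)

theorem coeFn_lpAct (t : ℝ≥0) (f : Lp ℝ p μ) : S.lpAct p hp' t f =ᵐ[μ] S.act t f :=
  MemLp.coeFn_toLp (S.memLp_act t hp.out hp' (Lp.memLp f))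

theorem lpAct_toLp (t : ℝ≥0) {f : E → ℝ} (hf : MemLp f p μ) :
    S.lpAct p hp' t hf.toLp = (S.memLp_act t hp.out hp' hf).toLp :=
  MemLp.toLp_congr (S.memLp_act t hp.out hp' (Lp.memLp hf.toLp)) _ (S.act_congr t hf.coeFn_toLp)

theorem norm_lpAct_le (t : ℝ≥0) (f : Lp ℝ p μ) : ‖S.lpAct p hp' t f‖ ≤ ‖f‖ := by
  have := (S.lpAct p hp' t).le_of_opNorm_le (LinearMap.mkContinuous_norm_le _ zero_le_one _) f
  simpa using this

theorem lpAct_zero (f : Lp ℝ p μ) : S.lpAct p hp' 0 f = f :=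
  Lp.ext ((S.coeFn_lpAct hp' 0 f).trans (S.act_zero (Lp.memLp f).1))

theorem lpAct_add (s t : ℝ≥0) (f : Lp ℝ p μ) :
    S.lpAct p hp' (s + t) f = S.lpAct p hp' s (S.lpAct p hp' t f) :=
  Lp.ext <| (S.coeFn_lpAct hp' _ f).trans <|
    (S.act_semigroup_ae s t ((Lp.memLp f).integrable hp.out)).trans <|
      (S.act_congr s (S.coeFn_lpAct hp' t f).symm).trans (S.coeFn_lpAct hp' s _).symm

theorem norm_lpAct_sub (t : ℝ≥0) (f : Lp ℝ p μ) :
    ‖S.lpAct p hp' t f - f‖ = (eLpNorm (fun x => S.act t f x - f x) p μ).toReal := by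
  rw [Lp.norm_def]
  congr 1
  refine eLpNorm_congr_ae ?_
  filter_upwards [Lp.coeFn_sub (S.lpAct p hp' t f) f, S.coeFn_lpAct hp' t f] with x h1 h2
  rw [h1, Pi.sub_apply, h2]

theorem tendsto_lpAct_two (f : Lp ℝ 2 μ) :
    Tendsto (fun t => S.lpAct 2 ENNReal.ofNat_ne_top t f) (𝓝[>] 0) (𝓝 f) := by
  rw [tendsto_iff_norm_sub_tendsto_zero]
  have h := (ENNReal.tendsto_toReal ENNReal.zero_ne_top).comp (S.continuous f (Lp.memLp f))
  refine h.congr fun t => ?_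
  rw [norm_lpAct_sub]
  rfl

/-- Strong continuity is assumed in `L²(μ)` only. Simple functions are in `L²(μ)`, where the norm
dominates the `L¹` norm, and are dense in `L¹(μ)`; contractivity does the rest. -/
theorem tendsto_lpAct_one (f : Lp ℝ 1 μ) :
    Tendsto (fun t => S.lpAct 1 ENNReal.one_ne_top t f) (𝓝[>] 0) (𝓝 f) := by
  rw [Metric.tendsto_nhds]
  intro ε hε
  obtain ⟨g, hg1, hg2⟩ := (Lp.memLp f).exists_simpleFunc_eLpNorm_sub_lt ENNReal.one_ne_top
    (ε := ENNReal.ofReal (ε / 3)) (by simpa using hε)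
  have hgL : MemLp g 2 μ := MemLp.mono_exponent (g.memLp_top μ) le_top
  have hF : ‖f - hg2.toLp‖ < ε / 3 := by
    rw [Lp.norm_def, ← ENNReal.lt_ofReal_iff_toReal_lt (Lp.eLpNorm_ne_top _)]
    refine (eLpNorm_congr_ae ?_).trans_lt hg1
    filter_upwards [Lp.coeFn_sub f hg2.toLp, hg2.coeFn_toLp] with x h1 h2
    rw [h1, Pi.sub_apply, h2, Pi.sub_apply]
  have h := (ENNReal.tendsto_toReal ENNReal.zero_ne_top).comp (S.continuous g hgL)
  have h' := h.eventually (gt_mem_nhds (show (0 : ℝ≥0∞).toReal < ε / 3 by simp; positivity))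
  filter_upwards [h'] with t ht
  set T := S.lpAct 1 ENNReal.one_ne_top t
  have hG : ‖T hg2.toLp - hg2.toLp‖ < ε / 3 := by
    refine lt_of_le_of_lt ?_ ht
    rw [Lp.norm_def]
    refine ENNReal.toReal_mono ?_ ?_
    · exact ((S.memLp_act t (by norm_num) ENNReal.ofNat_ne_top hgL).sub hgL).2.ne
    · refine (eLpNorm_congr_ae ?_).trans_le (eLpNorm_le_eLpNorm_of_exponent_le one_le_two
        ((S.memLp_act t (by norm_num) ENNReal.ofNat_ne_top hgL).sub hgL).1)
      filter_upwards [Lp.coeFn_sub (T hg2.toLp) hg2.toLp, hg2.coeFn_toLp,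
        S.coeFn_lpAct ENNReal.one_ne_top t hg2.toLp, S.act_congr t hg2.coeFn_toLp] with x h1 h2 h3 h4
      rw [h1, Pi.sub_apply, h2, h3, h4]
      rfl
  rw [dist_eq_norm]
  calc ‖T f - f‖ = ‖T (f - hg2.toLp) + (T hg2.toLp - hg2.toLp) - (f - hg2.toLp)‖ := by
        rw [map_sub]; congr 1; abel
    _ ≤ ‖T (f - hg2.toLp)‖ + ‖T hg2.toLp - hg2.toLp‖ + ‖f - hg2.toLp‖ :=
        (norm_sub_le _ _).trans (by gcongr; exact norm_add_le _ _)
    _ ≤ ‖f - hg2.toLp‖ + ‖T hg2.toLp - hg2.toLp‖ + ‖f - hg2.toLp‖ := by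
        gcongr; exact S.norm_lpAct_le _ _ _
    _ < ε := by linarith

/-- The semigroup on `L²(μ)`. -/
def l2 : ContractionSemigroup (Lp ℝ 2 μ) where
  T := S.lpAct 2 ENNReal.ofNat_ne_top
  norm_le := S.norm_lpAct_le _
  zero := S.lpAct_zero _
  add := S.lpAct_add _
  tendsto_zero := S.tendsto_lpAct_two

/-- The semigroup on `L¹(μ)`. -/
def l1 : ContractionSemigroup (Lp ℝ 1 μ) where
  T := S.lpAct 1 ENNReal.one_ne_top
  norm_le := S.norm_lpAct_le _
  zero := S.lpAct_zero _
  add := S.lpAct_add _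
  tendsto_zero := S.tendsto_lpAct_one

theorem tendsto_toLp_iff {f g : E → ℝ} (hf : MemLp f p μ) (hg : MemLp g p μ) :
    Tendsto (fun t : ℝ≥0 => eLpNorm (fun x => (t : ℝ)⁻¹ * (S.act t f x - f x) - g x) p μ)
      (𝓝[>] 0) (𝓝 0) ↔
    Tendsto (fun t : ℝ≥0 => (t : ℝ)⁻¹ • (S.lpAct p hp' t hf.toLp - hf.toLp)) (𝓝[>] 0)
      (𝓝 hg.toLp) := by
  have hM : ∀ t : ℝ≥0, MemLp (fun x => (t : ℝ)⁻¹ * (S.act t f x - f x) - g x) p μ := fun t =>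
    (((S.memLp_act t hp.out hp' hf).sub hf).const_mul _).sub hg
  have e : ∀ t : ℝ≥0, ‖(t : ℝ)⁻¹ • (S.lpAct p hp' t hf.toLp - hf.toLp) - hg.toLp‖
      = (eLpNorm (fun x => (t : ℝ)⁻¹ * (S.act t f x - f x) - g x) p μ).toReal := by
    intro t
    rw [lpAct_toLp, ← MemLp.toLp_sub, ← MemLp.toLp_const_smul, ← MemLp.toLp_sub, Lp.norm_toLp]
    rfl
  rw [tendsto_iff_norm_sub_tendsto_zero]
  simp_rw [e]
  rw [← ENNReal.toReal_zero, ENNReal.tendsto_toReal_iff (fun t => (hM t).2.ne) ENNReal.zero_ne_top]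

theorem hasGen_two_iff {f g : E → ℝ} (hf : MemLp f 2 μ) (hg : MemLp g 2 μ) :
    S.HasGen 2 f g ↔ S.l2.Gen hf.toLp hg.toLp := by
  rw [HasGen, S.tendsto_toLp_iff ENNReal.ofNat_ne_top hf hg]
  exact ⟨fun h => h.2.2, fun h => ⟨hf, hg, h⟩⟩

theorem hasGen_one_iff {f g : E → ℝ} (hf : MemLp f 1 μ) (hg : MemLp g 1 μ) :
    S.HasGen 1 f g ↔ S.l1.Gen hf.toLp hg.toLp := by
  rw [HasGen, S.tendsto_toLp_iff ENNReal.one_ne_top hf hg]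
  exact ⟨fun h => h.2.2, fun h => ⟨hf, hg, h⟩⟩

theorem hasGen_one_of_two {f g : E → ℝ} (h : S.HasGen 2 f g) : S.HasGen 1 f g := by
  refine ⟨h.1.mono_exponent one_le_two, h.2.1.mono_exponent one_le_two, ?_⟩
  refine tendsto_of_tendsto_of_tendsto_of_le_of_le tendsto_const_nhds h.2.2
    (fun _ => zero_le) fun t => ?_
  exact eLpNorm_le_eLpNorm_of_exponent_le one_le_two
    ((((S.memLp_act t one_le_two ENNReal.ofNat_ne_top h.1).sub h.1).const_mul _).sub h.2.1).1

theorem gen_one_ae {f g : E → ℝ} (h : S.HasGen 1 f g) : S.gen 1 f =ᵐ[μ] g := by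
  have h' := S.hasGen_gen ⟨g, h⟩
  rw [← MemLp.toLp_eq_toLp_iff h'.2.1 h.2.1]
  exact ((S.hasGen_one_iff h'.1 h'.2.1).1 h').unique ((S.hasGen_one_iff h.1 h.2.1).1 h)

theorem gen_two_ae {f g : E → ℝ} (h : S.HasGen 2 f g) : S.gen 2 f =ᵐ[μ] g := by
  have h' := S.hasGen_gen ⟨g, h⟩
  rw [← MemLp.toLp_eq_toLp_iff h'.2.1 h.2.1]
  exact ((S.hasGen_two_iff h'.1 h'.2.1).1 h').unique ((S.hasGen_two_iff h.1 h.2.1).1 h)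

theorem hasGen_two_act {f g : E → ℝ} (h : S.HasGen 2 f g) (t : ℝ≥0) :
    S.HasGen 2 (S.act t f) (S.act t g) := by
  have h1 := ((S.hasGen_two_iff h.1 h.2.1).1 h).apply t
  have e := @lpAct_toLp E _ μ S _ 2 _ ENNReal.ofNat_ne_top t
  refine (S.hasGen_two_iff (S.memLp_act t one_le_two ENNReal.ofNat_ne_top h.1)
    (S.memLp_act t one_le_two ENNReal.ofNat_ne_top h.2.1)).2 ?_
  rw [← e h.1, ← e h.2.1]
  exact h1

end MarkovSemigroup

/-! ### The carré du champ on the domain of the generator. -/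

/-- Pointwise convergence of an equi-Lipschitz family on a dense set implies pointwise convergence
everywhere. -/
theorem exists_tendsto_of_dense {ι Z Y : Type*} [PseudoMetricSpace Z] [PseudoMetricSpace Y]
    [CompleteSpace Y] {l : Filter ι} [l.NeBot] {F : ι → Z → Y} {K : ℝ} {s : Set Z}
    (hs : Dense s) (hF : ∀ i z z', dist (F i z) (F i z') ≤ K * dist z z')
    (h : ∀ z ∈ s, ∃ y, Tendsto (fun i => F i z) l (𝓝 y)) (z : Z) :
    ∃ y, Tendsto (fun i => F i z) l (𝓝 y) := by
  rw [← cauchy_map_iff_exists_tendsto]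
  refine Metric.cauchy_iff.2 ⟨inferInstance, fun ε hε => ?_⟩
  obtain ⟨z', hz', hd⟩ := Metric.dense_iff.1 hs z (ε / 4 / (|K| + 1)) (by positivity)
  rw [Metric.mem_ball] at hz'
  obtain ⟨y, hy⟩ := h z' hd
  have h1 : ∀ i, dist (F i z) (F i z') ≤ ε / 4 := fun i => by
    calc dist (F i z) (F i z') ≤ K * dist z z' := hF i z z'
      _ ≤ (|K| + 1) * dist z' z := by
        rw [dist_comm z]
        gcongr
        linarith [le_abs_self K]
      _ ≤ (|K| + 1) * (ε / 4 / (|K| + 1)) := by gcongr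
      _ = ε / 4 := by field_simp
  refine ⟨_, image_mem_map (hy (Metric.ball_mem_nhds y (show 0 < ε / 4 by positivity))), ?_⟩
  rintro _ ⟨i, hi, rfl⟩ _ ⟨j, hj, rfl⟩
  have hi' : dist (F i z') y < ε / 4 := hi
  have hj' : dist (F j z') y < ε / 4 := hj
  have := dist_triangle4_left (F i z) (F j z) (F i z') (F j z')
  have t1 := dist_triangle (F i z) (F i z') y
  have t2 := dist_triangle (F j z) (F j z') y
  have t3 := dist_triangle_right (F i z) (F j z) y
  linarith [h1 i, h1 j]

/-- A bilinear map is bounded as soon as it is bounded on pairs of small vectors. -/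
theorem norm_le_of_bilinear {D Y : Type*} [NormedAddCommGroup D] [NormedSpace ℝ D]
    [NormedAddCommGroup Y] [NormedSpace ℝ Y] {B : D → D → Y}
    (hl : ∀ (c : ℝ) a b, B (c • a) b = c • B a b) (hr : ∀ (c : ℝ) a b, B a (c • b) = c • B a b)
    (h : ∀ a b, ‖B a b‖ ≤ ‖a‖ ^ 2 + ‖b‖ ^ 2) (a b : D) : ‖B a b‖ ≤ 2 * ‖a‖ * ‖b‖ := by
  rcases eq_or_ne a 0 with rfl | ha
  · have := hl 0 0 b
    rw [zero_smul, zero_smul] at this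
    simp [this]
  rcases eq_or_ne b 0 with rfl | hb
  · have := hr 0 a 0
    rw [zero_smul, zero_smul] at this
    simp [this]
  have ha' := norm_pos_iff.2 ha
  have hb' := norm_pos_iff.2 hb
  have key := h (‖a‖⁻¹ • a) (‖b‖⁻¹ • b)
  rw [hl, hr, norm_smul, norm_smul, norm_smul, norm_smul, norm_inv, norm_inv, norm_norm, norm_norm,
    inv_mul_cancel₀ ha'.ne', inv_mul_cancel₀ hb'.ne'] at key
  have e : ‖B a b‖ = ‖a‖ * ‖b‖ * (‖a‖⁻¹ * (‖b‖⁻¹ * ‖B a b‖)) := by field_simp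
  rw [e]
  nlinarith [mul_pos ha' hb']

namespace MeasureTheory.Lp

variable {E : Type*} [MeasurableSpace E] (μ : Measure E)

/-- The product `L² × L² → L¹`. -/
def prodL : Lp ℝ 2 μ →L[ℝ] Lp ℝ 2 μ →L[ℝ] Lp ℝ 1 μ :=
  (ContinuousLinearMap.mul ℝ ℝ).holderL μ 2 2 1

variable {μ}

theorem coeFn_prodL (a b : Lp ℝ 2 μ) : prodL μ a b =ᵐ[μ] fun x => a x * b x :=
  ContinuousLinearMap.coeFn_holder _ a b

theorem prodL_comm (a b : Lp ℝ 2 μ) : prodL μ a b = prodL μ b a := by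
  refine Lp.ext ((coeFn_prodL a b).trans (EventuallyEq.trans ?_ (coeFn_prodL b a).symm))
  exact Eventually.of_forall fun x => mul_comm _ _

theorem prodL_toLp {f g : E → ℝ} (hf : MemLp f 2 μ) (hg : MemLp g 2 μ)
    (hfg : MemLp (fun x => f x * g x) 1 μ) : prodL μ hf.toLp hg.toLp = hfg.toLp := by
  refine Lp.ext ((coeFn_prodL _ _).trans (EventuallyEq.trans ?_ hfg.coeFn_toLp.symm))
  filter_upwards [hf.coeFn_toLp, hg.coeFn_toLp] with x h1 h2
  rw [h1, h2]

theorem integral_prodL_self (a : Lp ℝ 2 μ) : ∫ x, prodL μ a a x ∂μ = ‖a‖ ^ 2 := by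
  rw [← real_inner_self_eq_norm_sq, L2.inner_def]
  refine integral_congr_ae ?_
  filter_upwards [coeFn_prodL a a] with x hx
  rw [hx]
  rfl

theorem smul_nonneg_of_nonneg {c : ℝ} (hc : 0 ≤ c) {F : Lp ℝ 1 μ} (hF : 0 ≤ F) : 0 ≤ c • F := by
  rw [← Lp.coeFn_nonneg] at hF ⊢
  filter_upwards [hF, Lp.coeFn_smul c F] with x h1 h2
  rw [h2, Pi.smul_apply, smul_eq_mul]
  exact mul_nonneg hc h1

end MeasureTheory.Lp

open MeasureTheory.Lp (prodL)

theorem memLp_one_mul {E : Type*} [MeasurableSpace E] {μ : Measure E} {f g : E → ℝ}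
    (hf : MemLp f 2 μ) (hg : MemLp g 2 μ) : MemLp (fun x => f x * g x) 1 μ :=
  memLp_one_iff_integrable.2 (hf.integrable_mul hg)

namespace MarkovSemigroup

variable {E : Type*} [MeasurableSpace E] {μ : Measure E} [IsProbabilityMeasure μ]
  (S : MarkovSemigroup μ)

/-- The graph of the generator on `L²(μ)`, with the graph norm. -/
def graph : Submodule ℝ (Lp ℝ 2 μ × Lp ℝ 2 μ) where
  carrier := {q | S.l2.Gen q.1 q.2}
  add_mem' h h' := h.add h'
  zero_mem' := ContractionSemigroup.Gen.zero
  smul_mem' c _ h := h.smul c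

instance : NormedAddCommGroup S.graph := Submodule.normedAddCommGroup _

instance : NormedSpace ℝ S.graph := Submodule.normedSpace _

instance : AddCommGroup S.graph := NormedAddCommGroup.toAddCommGroup

instance : Module ℝ S.graph := NormedSpace.toModule

theorem graph_smul_fst (c : ℝ) (q : S.graph) : (c • q).1.1 = c • q.1.1 := rfl

theorem graph_add_fst (q r : S.graph) : (q + r).1.1 = q.1.1 + r.1.1 := rfl

variable {S} in
/-- A function of the domain, as an element of the graph. -/
def HasGen.toGraph {f g : E → ℝ} (h : S.HasGen 2 f g) : S.graph :=
  ⟨(h.1.toLp, h.2.1.toLp), (S.hasGen_two_iff h.1 h.2.1).1 h⟩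

/-- The action of the semigroup on the graph of its generator. -/
def graphAct (t : ℝ≥0) : S.graph →L[ℝ] S.graph :=
  (((S.l2.T t).prodMap (S.l2.T t)).comp S.graph.subtypeL).codRestrict S.graph
    fun q => q.2.apply t

/-- `(P_t (a b) - (P_t a) (P_t b)) / t`, which converges to `Γ(a, b)` as `t → 0`. -/
def preGamma (t : ℝ≥0) (a b : Lp ℝ 2 μ) : Lp ℝ 1 μ :=
  (t : ℝ)⁻¹ • (S.l1.T t (prodL μ a b) - prodL μ (S.l2.T t a) (S.l2.T t b))

theorem preGamma_add_left (t : ℝ≥0) (a b c : Lp ℝ 2 μ) :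
    S.preGamma t (a + b) c = S.preGamma t a c + S.preGamma t b c := by
  simp only [preGamma, map_add, ← smul_add, _root_.add_apply]
  congr 1
  abel

theorem preGamma_smul_left (t : ℝ≥0) (r : ℝ) (a c : Lp ℝ 2 μ) :
    S.preGamma t (r • a) c = r • S.preGamma t a c := by
  simp only [preGamma, map_smul, _root_.smul_apply]
  rw [← smul_sub, smul_comm]

theorem preGamma_comm (t : ℝ≥0) (a b : Lp ℝ 2 μ) : S.preGamma t a b = S.preGamma t b a := by
  rw [preGamma, Lp.prodL_comm a, Lp.prodL_comm (S.l2.T t a), preGamma]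

theorem preGamma_add_right (t : ℝ≥0) (a b c : Lp ℝ 2 μ) :
    S.preGamma t a (b + c) = S.preGamma t a b + S.preGamma t a c := by
  rw [preGamma_comm, preGamma_add_left, S.preGamma_comm t b, S.preGamma_comm t c]

theorem preGamma_smul_right (t : ℝ≥0) (r : ℝ) (a c : Lp ℝ 2 μ) :
    S.preGamma t a (r • c) = r • S.preGamma t a c := by
  rw [preGamma_comm, preGamma_smul_left, preGamma_comm]

omit [IsProbabilityMeasure μ] in
theorem sq_act_le_ae (t : ℝ≥0) {f : E → ℝ} (hf : MemLp f 2 μ) :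
    ∀ᵐ x ∂μ, S.act t f x * S.act t f x ≤ S.act t (fun y => f y * f y) x := by
  have h2 := memLp_one_iff_integrable.1 (memLp_one_mul hf hf)
  filter_upwards [S.ae_integrable t h2, S.ae_ae_kernel t hf.1.ae_eq_mk] with x h1 h3
  have hm : AEStronglyMeasurable f (S.P t x) := ⟨_, hf.1.stronglyMeasurable_mk, h3⟩
  have hL : MemLp f 2 (S.P t x) := by
    rw [memLp_two_iff_integrable_sq hm]
    simpa [sq] using h1
  have := variance_nonneg f (S.P t x)
  rw [variance_eq_sub hL] at this
  simp only [Pi.pow_apply, sq] at this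
  change (∫ y, f y ∂(S.P t x)) * (∫ y, f y ∂(S.P t x)) ≤ ∫ y, f y * f y ∂(S.P t x)
  linarith

theorem prodL_act_le (t : ℝ≥0) (a : Lp ℝ 2 μ) :
    prodL μ (S.l2.T t a) (S.l2.T t a) ≤ S.l1.T t (prodL μ a a) := by
  rw [← Lp.coeFn_le]
  filter_upwards [Lp.coeFn_prodL (S.l2.T t a) (S.l2.T t a), S.coeFn_lpAct ENNReal.ofNat_ne_top t a,
    S.coeFn_lpAct ENNReal.one_ne_top t (prodL μ a a), S.act_congr t (Lp.coeFn_prodL a a),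
    S.sq_act_le_ae t (Lp.memLp a)] with x h1 h2 h3 h4 h5
  rw [h1]
  change S.lpAct 2 ENNReal.ofNat_ne_top t a x * S.lpAct 2 ENNReal.ofNat_ne_top t a x ≤
    S.lpAct 1 ENNReal.one_ne_top t (prodL μ a a) x
  rw [h2, h3, h4]
  exact h5

theorem preGamma_nonneg (t : ℝ≥0) (a : Lp ℝ 2 μ) : 0 ≤ S.preGamma t a a :=
  Lp.smul_nonneg_of_nonneg (by positivity) (sub_nonneg.2 (S.prodL_act_le t a))

omit [IsProbabilityMeasure μ] in
theorem _root_.MeasureTheory.L1.norm_of_nonneg {F : Lp ℝ 1 μ} (h : 0 ≤ F) : ‖F‖ = ∫ x, F x ∂μ := by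
  rw [L1.norm_eq_integral_norm]
  refine integral_congr_ae ?_
  filter_upwards [(Lp.coeFn_nonneg F).2 h] with x hx
  exact Real.norm_of_nonneg hx

theorem integral_l1 (t : ℝ≥0) (F : Lp ℝ 1 μ) : ∫ x, S.l1.T t F x ∂μ = ∫ x, F x ∂μ := by
  rw [← S.integral_act t (L1.integrable_coeFn F)]
  exact integral_congr_ae (S.coeFn_lpAct ENNReal.one_ne_top t F)

/-- By positivity the `L¹` norm is an integral, and by invariance this integral is `(‖a‖² - ‖P_t
a‖²) / t`, which is controlled by `‖P_t a - a‖ ≤ t ‖L a‖`. -/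
theorem norm_preGamma_self_le (t : ℝ≥0) (q : S.graph) :
    ‖S.preGamma t q.1.1 q.1.1‖ ≤ 2 * ‖q‖ ^ 2 := by
  rw [L1.norm_of_nonneg (S.preGamma_nonneg t _)]
  set a := q.1.1
  have e : ∫ x, S.preGamma t a a x ∂μ = (t : ℝ)⁻¹ * (‖a‖ ^ 2 - ‖S.l2.T t a‖ ^ 2) := by
    rw [← Lp.integral_prodL_self, ← Lp.integral_prodL_self, ← S.integral_l1 t (prodL μ a a),
      ← integral_sub (L1.integrable_coeFn _) (L1.integrable_coeFn _), ← integral_const_mul]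
    refine integral_congr_ae ?_
    filter_upwards [Lp.coeFn_smul (t : ℝ)⁻¹
        (S.l1.T t (prodL μ a a) - prodL μ (S.l2.T t a) (S.l2.T t a)),
      Lp.coeFn_sub (S.l1.T t (prodL μ a a)) (prodL μ (S.l2.T t a) (S.l2.T t a))] with x h1 h2
    rw [preGamma, h1, Pi.smul_apply, h2]
    rfl
  rw [e]
  have hG : S.l2.Gen a q.1.2 := q.2
  have h1 : ‖a‖ - ‖S.l2.T t a‖ ≤ t * ‖q‖ := by
    have hq : ‖q.1.2‖ ≤ ‖q‖ := norm_snd_le q.1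
    calc ‖a‖ - ‖S.l2.T t a‖ ≤ ‖S.l2.T t a - a‖ := by
          rw [norm_sub_rev]; exact norm_sub_norm_le _ _
      _ ≤ t * ‖q.1.2‖ := hG.norm_sub_le t
      _ ≤ _ := by gcongr
  have h2 : ‖a‖ ≤ ‖q‖ := norm_fst_le q.1
  have h3 : ‖S.l2.T t a‖ ≤ ‖a‖ := S.l2.norm_le t a
  have h4 : ‖a‖ ^ 2 - ‖S.l2.T t a‖ ^ 2 ≤ t * (2 * ‖q‖ ^ 2) := by
    calc ‖a‖ ^ 2 - ‖S.l2.T t a‖ ^ 2 = (‖a‖ - ‖S.l2.T t a‖) * (‖a‖ + ‖S.l2.T t a‖) := by ring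
      _ ≤ (t * ‖q‖) * (‖q‖ + ‖q‖) := by
        gcongr
        linarith
      _ = _ := by ring
  -- At `t = 0` the quotient is zero by the convention `0⁻¹ = 0`, so the bound holds for every `t`.
  rcases eq_or_ne (t : ℝ) 0 with ht | ht
  · rw [ht, inv_zero, zero_mul]; positivity
  · rw [inv_mul_le_iff₀ (lt_of_le_of_ne t.coe_nonneg ht.symm)]
    exact h4

theorem norm_preGamma_le (t : ℝ≥0) (q r : S.graph) :
    ‖S.preGamma t q.1.1 r.1.1‖ ≤ 2 * ‖q‖ * ‖r‖ := by
  have hl : ∀ (c : ℝ) (a b : S.graph), S.preGamma t (c • a).1.1 b.1.1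
      = c • S.preGamma t a.1.1 b.1.1 := fun c a b => by
    rw [graph_smul_fst, preGamma_smul_left]
  have hr : ∀ (c : ℝ) (a b : S.graph), S.preGamma t a.1.1 (c • b).1.1
      = c • S.preGamma t a.1.1 b.1.1 := fun c a b => by
    rw [graph_smul_fst, preGamma_smul_right]
  refine norm_le_of_bilinear (B := fun q r : S.graph => S.preGamma t q.1.1 r.1.1) hl hr
    (fun a b => ?_) q r
  set x := a.1.1
  set y := b.1.1
  -- Polarisation: positivity at `x + y` and at `x - y` gives `2 |B(x, y)| ≤ B(x, x) + B(y, y)`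
  -- almost everywhere.
  have h1 := S.preGamma_nonneg t (x + y)
  have h2 := S.preGamma_nonneg t (x + (-1 : ℝ) • y)
  simp only [preGamma_add_left, preGamma_add_right, preGamma_smul_left, preGamma_smul_right,
    S.preGamma_comm t y x] at h1 h2
  have h3 : |(2 : ℝ) • S.preGamma t x y| ≤ S.preGamma t x x + S.preGamma t y y := by
    have e1 : S.preGamma t x x + S.preGamma t x y + (S.preGamma t x y + S.preGamma t y y)
        = S.preGamma t x x + S.preGamma t y y - -((2 : ℝ) • S.preGamma t x y) := by module
    have e2 : S.preGamma t x x + (-1 : ℝ) • S.preGamma t x y + (-1 : ℝ) • (S.preGamma t x y +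
        (-1 : ℝ) • S.preGamma t y y)
        = S.preGamma t x x + S.preGamma t y y - (2 : ℝ) • S.preGamma t x y := by module
    rw [e1] at h1
    rw [e2] at h2
    exact sup_le (sub_nonneg.1 h2) (sub_nonneg.1 h1)
  have h4 := norm_le_norm_of_abs_le_abs (h3.trans (le_abs_self _))
  rw [norm_smul, Real.norm_two] at h4
  have h5 := norm_add_le (S.preGamma t x x) (S.preGamma t y y)
  have h6 := S.norm_preGamma_self_le t a
  have h7 := S.norm_preGamma_self_le t b
  change ‖S.preGamma t x y‖ ≤ _
  linarith

theorem tendsto_prodL_sub {a a' b b' : Lp ℝ 2 μ} (ha : S.l2.Gen a a') (hb : S.l2.Gen b b') :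
    Tendsto (fun t : ℝ≥0 => (t : ℝ)⁻¹ • (prodL μ (S.l2.T t a) (S.l2.T t b) - prodL μ a b))
      (𝓝[>] 0) (𝓝 (prodL μ a b' + prodL μ a' b)) := by
  have hc : Continuous fun q : Lp ℝ 2 μ × Lp ℝ 2 μ => prodL μ q.1 q.2 :=
    (prodL μ).isBoundedBilinearMap.continuous
  have h1 := (hc.tendsto (a, b')).comp ((S.l2.tendsto_zero a).prodMk_nhds hb)
  have h2 := (hc.tendsto (a', b)).comp (Tendsto.prodMk_nhds ha (tendsto_const_nhds (x := b)))
  refine (h1.add h2).congr fun t => ?_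
  simp only [Function.comp, map_smul, _root_.smul_apply, map_sub,
    _root_.sub_apply]
  rw [← smul_add]
  congr 1
  abel

/-- The difference of the two quotients is that of `(P_t a)(P_t b)`, which always converges by the
product rule. This gives `L(ab) = Γ(a, b) + a L b + b L a`. -/
theorem tendsto_preGamma_iff {a a' b b' : Lp ℝ 2 μ} {y : Lp ℝ 1 μ} (ha : S.l2.Gen a a')
    (hb : S.l2.Gen b b') : Tendsto (fun t => S.preGamma t a b) (𝓝[>] 0) (𝓝 y) ↔
      S.l1.Gen (prodL μ a b) (y + (prodL μ a b' + prodL μ a' b)) := by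
  have h := S.tendsto_prodL_sub ha hb
  constructor
  · intro hy
    refine (hy.add h).congr fun t => ?_
    rw [preGamma, ← smul_add]
    congr 1
    abel
  · intro hy
    have := Tendsto.sub hy h
    rw [add_sub_cancel_right] at this
    refine this.congr fun t => ?_
    rw [preGamma, ← smul_sub]
    congr 1
    abel

variable {S}

theorem dense_toGraph {A : Set (E → ℝ)} (hA : S.IsCore A) :
    Dense {q : S.graph | ∃ f ∈ A, ∃ (g : E → ℝ) (h : S.HasGen 2 f g), h.toGraph = q} := by
  rw [Metric.dense_iff]
  intro q ε hε
  have hq : S.HasGen 2 q.1.1 q.1.2 := by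
    rw [S.hasGen_two_iff (Lp.memLp _) (Lp.memLp _), Lp.toLp_coeFn, Lp.toLp_coeFn]
    exact q.2
  obtain ⟨f, hf, h1, h2⟩ := hA.2 q.1.1 ⟨_, hq⟩ ε hε
  have hfg := S.hasGen_gen (hA.1 f hf)
  refine ⟨hfg.toGraph, ?_, f, hf, _, hfg, rfl⟩
  rw [Metric.mem_ball, dist_comm, dist_eq_norm]
  have key : ∀ (u : Lp ℝ 2 μ) (v w : E → ℝ) (hv : MemLp v 2 μ), w =ᵐ[μ] u →
      eLpNorm (fun x => w x - v x) 2 μ < ENNReal.ofReal ε → ‖u - hv.toLp‖ < ε := by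
    intro u v w hv hw h
    rw [Lp.norm_def, ← ENNReal.lt_ofReal_iff_toReal_lt (Lp.eLpNorm_ne_top _)]
    refine (eLpNorm_congr_ae ?_).trans_lt h
    filter_upwards [Lp.coeFn_sub u hv.toLp, hv.coeFn_toLp, hw] with x e1 e2 e3
    rw [e1, Pi.sub_apply, e2, e3]
  exact max_lt (key _ _ _ hfg.1 EventuallyEq.rfl h1) (key _ _ _ hfg.2.1 (S.gen_two_ae hq) h2)

/-- On the algebra the product is again in the domain, so the limit exists. The bound in the graph
norm makes the forms equi-Lipschitz in each variable, and density of the core extends the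
convergence one variable at a time. -/
theorem IsDiffusionAlgebra.exists_tendsto_preGamma {A : Subalgebra ℝ (E → ℝ)}
    (hA : S.IsDiffusionAlgebra A) (q r : S.graph) :
    ∃ y, Tendsto (fun t => S.preGamma t q.1.1 r.1.1) (𝓝[>] 0) (𝓝 y) := by
  have hd := dense_toGraph hA.core
  have hLip : ∀ (r : S.graph) (t : ℝ≥0) (z z' : S.graph),
      dist (S.preGamma t z.1.1 r.1.1) (S.preGamma t z'.1.1 r.1.1) ≤ (2 * ‖r‖) * dist z z' := by
    intro r t z z'
    have e : S.preGamma t z.1.1 r.1.1 - S.preGamma t z'.1.1 r.1.1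
        = S.preGamma t (z - z').1.1 r.1.1 := by
      have : (z - z').1.1 = z.1.1 + (-1 : ℝ) • z'.1.1 := by
        rw [neg_one_smul, ← sub_eq_add_neg]; rfl
      rw [this, preGamma_add_left, preGamma_smul_left, neg_one_smul, sub_eq_add_neg]
    rw [dist_eq_norm, dist_eq_norm, e]
    refine (S.norm_preGamma_le t _ _).trans (le_of_eq ?_)
    ring
  refine exists_tendsto_of_dense (F := fun t (z : S.graph) => S.preGamma t z.1.1 r.1.1) hd
    (hLip r) ?_ q
  rintro _ ⟨f, hf, f', hff, rfl⟩
  simp_rw [S.preGamma_comm _ _ r.1.1]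
  refine exists_tendsto_of_dense
    (F := fun t (z : S.graph) => S.preGamma t z.1.1 hff.toGraph.1.1) hd (hLip _) ?_ r
  rintro _ ⟨g, hg, g', hgg, rfl⟩
  have h1 := S.hasGen_gen (hA.core.1 _ (A.mul_mem hg hf))
  have h2 := S.hasGen_one_of_two h1
  have h3 := (S.hasGen_one_iff h2.1 h2.2.1).1 h2
  have e := Lp.prodL_toLp hgg.1 hff.1 h2.1
  refine ⟨h2.2.1.toLp - (prodL μ hgg.1.toLp hff.2.1.toLp + prodL μ hgg.2.1.toLp hff.1.toLp), ?_⟩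
  refine (S.tendsto_preGamma_iff hgg.toGraph.2 hff.toGraph.2).2 ?_
  change S.l1.Gen (prodL μ hgg.1.toLp hff.1.toLp) _
  rw [e]
  have e' := sub_add_cancel (h2.2.1.toLp (S.gen 2 (g * f)))
    (prodL μ hgg.1.toLp hff.2.1.toLp + prodL μ hgg.2.1.toLp hff.1.toLp)
  exact e'.symm ▸ h3

/-- The carré du champ extends to a bounded bilinear map from the domain of the generator on
`L²(μ)`, with the graph norm, to `L¹(μ)`. -/
theorem IsDiffusionAlgebra.exists_carreDuChamp {A : Subalgebra ℝ (E → ℝ)}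
    (hA : S.IsDiffusionAlgebra A) : ∃ Γ : S.graph →L[ℝ] S.graph →L[ℝ] Lp ℝ 1 μ,
      ∀ q r : S.graph, Tendsto (fun t => S.preGamma t q.1.1 r.1.1) (𝓝[>] 0) (𝓝 (Γ q r)) := by
  choose G hG using hA.exists_tendsto_preGamma
  refine ⟨LinearMap.mkContinuous₂ (LinearMap.mk₂ ℝ G ?_ ?_ ?_ ?_) 2 ?_, fun q r => hG q r⟩
  · intro a b c
    refine tendsto_nhds_unique (hG _ _) (((hG a c).add (hG b c)).congr fun t => ?_)
    rw [graph_add_fst, preGamma_add_left]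
  · intro c a b
    refine tendsto_nhds_unique (hG _ _) (((hG a b).const_smul c).congr fun t => ?_)
    rw [graph_smul_fst, preGamma_smul_left]
  · intro a b c
    refine tendsto_nhds_unique (hG _ _) (((hG a b).add (hG a c)).congr fun t => ?_)
    rw [graph_add_fst, preGamma_add_right]
  · intro c a b
    refine tendsto_nhds_unique (hG _ _) (((hG a b).const_smul c).congr fun t => ?_)
    rw [graph_smul_fst, preGamma_smul_right]
  · intro a b
    exact le_of_tendsto (hG a b).norm (Eventually.of_forall fun t => S.norm_preGamma_le t a b)

variable (S) in
/-- `Γ` is the carré du champ on the domain of the generator on `L²(μ)`. -/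
def IsCarreDuChamp (Γ : S.graph →L[ℝ] S.graph →L[ℝ] Lp ℝ 1 μ) : Prop :=
  ∀ q r : S.graph, Tendsto (fun t => S.preGamma t q.1.1 r.1.1) (𝓝[>] 0) (𝓝 (Γ q r))

variable {Γ : S.graph →L[ℝ] S.graph →L[ℝ] Lp ℝ 1 μ}

theorem IsCarreDuChamp.comm (hΓ : S.IsCarreDuChamp Γ) (q r : S.graph) : Γ q r = Γ r q :=
  tendsto_nhds_unique (hΓ q r) ((hΓ r q).congr fun _ => S.preGamma_comm _ _ _)

theorem IsCarreDuChamp.nonneg (hΓ : S.IsCarreDuChamp Γ) (q : S.graph) : 0 ≤ Γ q q :=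
  ge_of_tendsto' (hΓ q q) fun t => S.preGamma_nonneg t _

theorem IsCarreDuChamp.gen (hΓ : S.IsCarreDuChamp Γ) (q r : S.graph) :
    S.l1.Gen (prodL μ q.1.1 r.1.1) (Γ q r + (prodL μ q.1.1 r.1.2 + prodL μ q.1.2 r.1.1)) :=
  (S.tendsto_preGamma_iff q.2 r.2).1 (hΓ q r)

/-- Shows in particular that products of functions in the `L²(μ)`-domain lie in the `L¹(μ)`-domain,
so that `gen 1` inside `gamma` takes its intended value, not the default `0`. -/
theorem IsCarreDuChamp.gamma_ae (hΓ : S.IsCarreDuChamp Γ) {f f' g g' : E → ℝ}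
    (hf : S.HasGen 2 f f') (hg : S.HasGen 2 g g') :
    S.gamma f g =ᵐ[μ] Γ hf.toGraph hg.toGraph := by
  have h1 := hΓ.gen hf.toGraph hg.toGraph
  set F := Γ hf.toGraph hg.toGraph +
    (prodL μ hf.1.toLp hg.2.1.toLp + prodL μ hf.2.1.toLp hg.1.toLp) with hF
  have h2 : S.HasGen 1 (fun x => f x * g x) F := by
    rw [S.hasGen_one_iff (memLp_one_mul hf.1 hg.1) (Lp.memLp F), Lp.toLp_coeFn,
      ← Lp.prodL_toLp hf.1 hg.1]
    exact h1
  filter_upwards [S.gen_one_ae h2, S.gen_two_ae hf, S.gen_two_ae hg,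
    Lp.coeFn_add (Γ hf.toGraph hg.toGraph)
      (prodL μ hf.1.toLp hg.2.1.toLp + prodL μ hf.2.1.toLp hg.1.toLp),
    Lp.coeFn_add (prodL μ hf.1.toLp hg.2.1.toLp) (prodL μ hf.2.1.toLp hg.1.toLp),
    Lp.coeFn_prodL hf.1.toLp hg.2.1.toLp, Lp.coeFn_prodL hf.2.1.toLp hg.1.toLp,
    hf.1.coeFn_toLp, hf.2.1.coeFn_toLp, hg.1.coeFn_toLp, hg.2.1.coeFn_toLp]
    with x e1 e2 e3 e4 e5 e6 e7 e8 e9 e10 e11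
  rw [gamma, e1, e2, e3, hF, e4, Pi.add_apply, e5, Pi.add_apply, e6, e7, e8, e9, e10, e11]
  ring

end MarkovSemigroup

/-! ### Curvature and the reverse local Poincaré inequality. -/

/-- `(e^{ρ t} - 1) / ρ`, replaced by its limit `t` for `ρ = 0`. -/
def curvTime (ρ t : ℝ) : ℝ := if ρ = 0 then t else (Real.exp (ρ * t) - 1) / ρ

theorem curvTime_zero_right (ρ : ℝ) : curvTime ρ 0 = 0 := by
  simp [curvTime]

theorem hasDerivAt_curvTime (ρ t : ℝ) : HasDerivAt (curvTime ρ) (Real.exp (ρ * t)) t := by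
  by_cases h : ρ = 0
  · subst h
    have : curvTime 0 = id := by ext t; simp [curvTime]
    rw [this]
    simpa using hasDerivAt_id t
  · have e : curvTime ρ = fun t => (Real.exp (ρ * t) - 1) / ρ := by ext t; simp [curvTime, h]
    rw [e]
    have h1 := ((((hasDerivAt_id t).const_mul ρ).exp).sub_const 1).div_const ρ
    refine h1.congr_deriv ?_
    simp only [id, mul_one]
    field_simp

theorem curvTime_nonneg {ρ t : ℝ} (hρ : 0 ≤ ρ) (ht : 0 ≤ t) : 0 ≤ curvTime ρ t := by
  rw [curvTime]
  split_ifs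
  · exact ht
  · exact div_nonneg (sub_nonneg.2 (Real.one_le_exp (by positivity))) hρ

/-- Integration of the differential inequalities `φ' ≥ ρ φ` and `ψ' = φ`. -/
theorem curvTime_mul_le {ρ t : ℝ} (ht : 0 ≤ t) {φ φ' ψ : ℝ → ℝ} (hφ : ContinuousOn φ (Icc 0 t))
    (hψ : ContinuousOn ψ (Icc 0 t))
    (hφ' : ∀ s ∈ Ico 0 t, HasDerivWithinAt φ (φ' s) (Ici s) s)
    (hψ' : ∀ s ∈ Ico 0 t, HasDerivWithinAt ψ (φ s) (Ici s) s)
    (h : ∀ s ∈ Ico 0 t, ρ * φ s ≤ φ' s) : curvTime ρ t * φ 0 ≤ ψ t - ψ 0 := by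
  have he : ∀ c s : ℝ, HasDerivAt (fun s => Real.exp (c * s)) (c * Real.exp (c * s)) s := by
    intro c s
    refine (((hasDerivAt_id s).const_mul c).exp).congr_deriv ?_
    simp [mul_comm]
  -- Grönwall: `φ(s) e^{-ρ s}` has nonnegative right derivative.
  have h1 : ∀ s ∈ Icc 0 t, φ 0 * Real.exp (ρ * s) ≤ φ s := by
    intro s hs
    have := image_le_of_deriv_right_le_deriv_boundary (f := fun _ => φ 0) (f' := fun _ => 0)
      (B := fun s => φ s * Real.exp (-ρ * s))
      (B' := fun s => φ' s * Real.exp (-ρ * s) + φ s * (-ρ * Real.exp (-ρ * s))) (a := 0) (b := t)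
      continuousOn_const (fun x _ => hasDerivWithinAt_const _ _ _) (by simp)
      (hφ.mul (by fun_prop)) (fun x hx => (hφ' x hx).mul (he _ x).hasDerivWithinAt)
      (fun x hx => by nlinarith [h x hx, Real.exp_pos (-ρ * x)]) hs
    calc φ 0 * Real.exp (ρ * s) ≤ φ s * Real.exp (-ρ * s) * Real.exp (ρ * s) := by gcongr
      _ = φ s := by rw [mul_assoc, ← Real.exp_add]; simp
  have hc : Continuous (curvTime ρ) :=
    continuous_iff_continuousAt.2 fun s => (hasDerivAt_curvTime ρ s).continuousAt
  have := image_le_of_deriv_right_le_deriv_boundary (f := fun s => ψ 0 + curvTime ρ s * φ 0)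
    (f' := fun s => Real.exp (ρ * s) * φ 0) (B := ψ) (B' := φ) (a := 0) (b := t)
    (by fun_prop)
    (fun x _ => (((hasDerivAt_curvTime ρ x).mul_const _).const_add _).hasDerivWithinAt)
    (by simp [curvTime_zero_right]) hψ hψ'
    (fun x hx => by rw [mul_comm]; exact h1 x ⟨hx.1, hx.2.le⟩) (right_mem_Icc.2 ht)
  linarith

theorem ContractionSemigroup.continuous_apply {X ι : Type*} [NormedAddCommGroup X]
    [NormedSpace ℝ X] [TopologicalSpace ι] (T : ContractionSemigroup X) {r : ι → ℝ≥0} {z : ι → X}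
    (hr : Continuous r) (hz : Continuous z) : Continuous fun i => T.T (r i) (z i) :=
  continuous_iff_continuousAt.2 fun i => T.tendsto_apply (hr.tendsto i) (hz.tendsto i)

theorem Submodule.hasDerivAt_of_coe {V : Type*} [NormedAddCommGroup V] [NormedSpace ℝ V]
    {P : Submodule ℝ V} {f : ℝ → P} {f' : P} {x : ℝ}
    (h : HasDerivAt (fun x => (f x : V)) (f' : V) x) : HasDerivAt f f' x := by
  rw [hasDerivAt_iff_tendsto_slope] at h ⊢
  rw [tendsto_subtype_rng]
  exact h

theorem continuous_apply_prodL {E X : Type*} [MeasurableSpace E] {μ : Measure E}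
    [TopologicalSpace X] (ℓ : Lp ℝ 1 μ →L[ℝ] ℝ) {f g : X → Lp ℝ 2 μ} (hf : Continuous f)
    (hg : Continuous g) : Continuous fun a => ℓ (prodL μ (f a) (g a)) :=
  ℓ.continuous.comp (((prodL μ).continuous.comp hf).clm_apply hg)

namespace MarkovSemigroup

variable {E : Type*} [MeasurableSpace E] {μ : Measure E} [IsProbabilityMeasure μ]
  {S : MarkovSemigroup μ}

theorem graph_ext {q r : S.graph} (h : q.1.1 = r.1.1) : q = r := by
  have h1 : S.l2.Gen r.1.1 q.1.2 := h ▸ q.2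
  exact Subtype.ext (Prod.ext h (h1.unique r.2))

theorem continuous_graphAct (q : S.graph) : Continuous fun u => S.graphAct u q :=
  Continuous.subtype_mk ((S.l2.continuous_orbit q.1.1).prodMk (S.l2.continuous_orbit q.1.2)) _

/-- The orbit of `f` is differentiable in the graph norm if `f` and `L f` are in the domain. -/
theorem hasDerivAt_graphAct {q r : S.graph} (h : r.1.1 = q.1.2) {u : ℝ} (hu : 0 < u) :
    HasDerivAt (fun u : ℝ => S.graphAct u.toNNReal q) (S.graphAct u.toNNReal r) u := by
  have h1 : S.l2.Gen q.1.1 r.1.1 := h ▸ q.2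
  have h2 : S.l2.Gen q.1.2 r.1.2 := h ▸ r.2
  exact Submodule.hasDerivAt_of_coe (P := S.graph) ((h1.hasDerivAt hu).prodMk (h2.hasDerivAt hu))

theorem l1_nonneg (t : ℝ≥0) {F : Lp ℝ 1 μ} (hF : 0 ≤ F) : 0 ≤ S.l1.T t F := by
  rw [← Lp.coeFn_nonneg] at hF ⊢
  filter_upwards [S.coeFn_lpAct ENNReal.one_ne_top t F, S.ae_ae_kernel t hF] with x h1 h2
  change 0 ≤ S.lpAct 1 ENNReal.one_ne_top t F x
  rw [h1]
  exact integral_nonneg_of_ae h2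

variable {Γ : S.graph →L[ℝ] S.graph →L[ℝ] Lp ℝ 1 μ}

/-- The reverse local Poincaré inequality along an orbit on which `Γ₂ ≥ (ρ / 2) Γ`. -/
theorem IsCarreDuChamp.curvTime_mul_le_of_orbit (hΓ : S.IsCarreDuChamp Γ) {ρ : ℝ} {q r : S.graph}
    (hr : r.1.1 = q.1.2)
    (hcurv : ∀ u, ∃ y, S.l1.Gen (Γ (S.graphAct u q) (S.graphAct u q)) y ∧
      ρ • Γ (S.graphAct u q) (S.graphAct u q) ≤
        y - (2 : ℝ) • Γ (S.graphAct u r) (S.graphAct u q))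
    {ℓ : Lp ℝ 1 μ →L[ℝ] ℝ} (hℓ : ∀ F, 0 ≤ F → 0 ≤ ℓ F) (t : ℝ≥0) :
    curvTime ρ t * ℓ (Γ (S.graphAct t q) (S.graphAct t q)) ≤
      ℓ (S.l1.T t (prodL μ q.1.1 q.1.1)) - ℓ (prodL μ (S.l2.T t q.1.1) (S.l2.T t q.1.1)) := by
  choose y hy hyρ using hcurv
  -- `U s` stands for `P_{t-s} f` and `V s` for `P_{t-s} L f`. Differentiability of `U` in the graph
  -- norm is what allows `Γ(U, U)` to be differentiated.
  let U : ℝ → S.graph := fun s => S.graphAct (t - s : ℝ).toNNReal q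
  let V : ℝ → S.graph := fun s => S.graphAct (t - s : ℝ).toNNReal r
  have hUc : Continuous U := 
    (continuous_graphAct q).comp (continuous_real_toNNReal.comp (continuous_const.sub continuous_id))
  have hU : ∀ s ∈ Ico (0 : ℝ) t, HasDerivAt U (-V s) s := fun s hs =>
    HasDerivAt.comp_const_sub (t : ℝ) s (hasDerivAt_graphAct hr (sub_pos.2 hs.2))
  have hU1 : ∀ s ∈ Ico (0 : ℝ) t, HasDerivAt (fun s => (U s).1.1) (-(V s).1.1) s := fun s hs =>
    ((ContinuousLinearMap.fst ℝ _ _).comp S.graph.subtypeL).hasFDerivAt.comp_hasDerivAt s (hU s hs)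
  have hU1c : Continuous fun s => (U s).1.1 :=
    continuous_fst.comp (continuous_subtype_val.comp hUc)
  have hV : ∀ s, (V s).1.1 = (U s).1.2 := fun s => by
    change S.l2.T _ r.1.1 = S.l2.T _ q.1.2
    rw [hr]
  have hG : ∀ s ∈ Ico (0 : ℝ) t,
      HasDerivAt (fun s => Γ (U s) (U s)) (-((2 : ℝ) • Γ (V s) (U s))) s := by
    intro s hs
    have h1 := (Γ.hasFDerivAt.comp_hasDerivAt s (hU s hs)).clm_apply (hU s hs)
    refine h1.congr_deriv ?_
    simp only [map_neg, _root_.neg_apply, Function.comp]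
    rw [hΓ.comm (U s) (V s)]
    module
  have hQ : ∀ s ∈ Ico (0 : ℝ) t, HasDerivAt (fun s => prodL μ (U s).1.1 (U s).1.1)
      (-(prodL μ (U s).1.1 (U s).1.2 + prodL μ (U s).1.2 (U s).1.1)) s := by
    intro s hs
    have h1 := ((prodL μ).hasFDerivAt.comp_hasDerivAt s (hU1 s hs)).clm_apply (hU1 s hs)
    refine h1.congr_deriv ?_
    simp only [map_neg, _root_.neg_apply, Function.comp, hV]
    abel
  have hφc : Continuous fun s : ℝ => ℓ (S.l1.T s.toNNReal (Γ (U s) (U s))) :=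
    ℓ.continuous.comp (S.l1.continuous_apply continuous_real_toNNReal
      ((Γ.continuous.comp hUc).clm_apply hUc))
  have hψc : Continuous fun s : ℝ => ℓ (S.l1.T s.toNNReal (prodL μ (U s).1.1 (U s).1.1)) :=
    ℓ.continuous.comp (S.l1.continuous_apply continuous_real_toNNReal
      (((prodL μ).continuous.comp hU1c).clm_apply hU1c))
  have key := curvTime_mul_le (ρ := ρ) t.coe_nonneg hφc.continuousOn hψc.continuousOn
    (φ' := fun s => ℓ (S.l1.T s.toNNReal
      (y (t - s : ℝ).toNNReal + -((2 : ℝ) • Γ (V s) (U s)))))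
    (fun s hs => ℓ.hasFDerivAt.comp_hasDerivWithinAt s
      (ContractionSemigroup.hasDerivWithinAt_apply hs.1 (hG s hs).hasDerivWithinAt
        (hy (t - s : ℝ).toNNReal)))
    (fun s hs => by
      have h1 := ContractionSemigroup.hasDerivWithinAt_apply hs.1 (hQ s hs).hasDerivWithinAt
        (hΓ.gen (U s) (U s))
      -- `L(U²)` is `Γ(U, U) + 2 U L U`, and the time derivative of `U²` cancels the last term:
      -- hence `ψ' = φ`.
      rw [add_neg_cancel_right] at h1
      exact ℓ.hasFDerivAt.comp_hasDerivWithinAt s h1)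
    (fun s hs => by
      have h1 := hℓ _ (l1_nonneg (S := S) s.toNNReal (sub_nonneg.2 (hyρ (t - s : ℝ).toNNReal)))
      rw [map_sub, map_sub, map_smul, map_smul, smul_eq_mul, sub_nonneg] at h1
      rw [← sub_eq_add_neg]
      exact h1)
  have e0 : U 0 = S.graphAct t q := by simp [U]
  have e1 : U t = q := by
    refine graph_ext ?_
    change S.l2.T (t - t : ℝ).toNNReal q.1.1 = _
    rw [sub_self, Real.toNNReal_zero, S.l2.zero]
  simp only [e0, e1, Real.toNNReal_coe, Real.toNNReal_zero, S.l1.zero] at key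
  exact key

theorem toGraph_act {f g : E → ℝ} (h : S.HasGen 2 f g) (u : ℝ≥0) :
    (S.hasGen_two_act h u).toGraph = S.graphAct u h.toGraph :=
  graph_ext (S.lpAct_toLp ENNReal.ofNat_ne_top u h.1).symm

theorem toGraph_congr {f g f' g' : E → ℝ} (h : S.HasGen 2 f g) (h' : S.HasGen 2 f' g')
    (e : f =ᵐ[μ] f') : h.toGraph = h'.toGraph :=
  graph_ext (MemLp.toLp_congr h.1 h'.1 e)

/-- `Γ₂ ≥ ρ Γ` along the orbit of a nice function, in `L¹(μ)`. -/
theorem IsCarreDuChamp.exists_gen_orbit (hΓ : S.IsCarreDuChamp Γ) {ρ : ℝ} (hρ : 0 ≤ ρ)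
    {f g f' : E → ℝ} (hfg : S.HasGen 2 f g) (h1 : S.HasGen 2 (S.gen 2 f) f') (u : ℝ≥0)
    (d0 : S.Dom 2 (S.act u f)) (d1 : S.Dom 2 (S.gen 2 (S.act u f)))
    (d2 : S.Dom 1 (S.gamma (S.act u f) (S.act u f)))
    (d3 : ∀ᵐ x ∂μ, ρ * S.gamma (S.act u f) (S.act u f) x ≤
      S.gamma2 (S.act u f) (S.act u f) x) :
    ∃ y, S.l1.Gen (Γ (S.graphAct u hfg.toGraph) (S.graphAct u hfg.toGraph)) y ∧
      ρ • Γ (S.graphAct u hfg.toGraph) (S.graphAct u hfg.toGraph) ≤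
        y - (2 : ℝ) • Γ (S.graphAct u h1.toGraph) (S.graphAct u hfg.toGraph) := by
  have hg : S.gen 2 f =ᵐ[μ] g := S.gen_two_ae hfg
  have k1 := S.hasGen_gen d0
  have k2 := S.hasGen_gen d1
  have k3 := S.hasGen_gen d2
  have e1 : k1.toGraph = S.graphAct u hfg.toGraph := by
    rw [← toGraph_act]
    exact toGraph_congr _ _ EventuallyEq.rfl
  have e2 : k2.toGraph = S.graphAct u h1.toGraph := by
    rw [← toGraph_act]
    exact toGraph_congr _ _ ((S.gen_two_ae (S.hasGen_two_act hfg u)).trans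
      (S.act_congr u hg).symm)
  have g1 := hΓ.gamma_ae k1 k1
  have g2 := hΓ.gamma_ae k2 k1
  have g3 := hΓ.gamma_ae k1 k2
  have k4 := (S.hasGen_one_iff k3.1 k3.2.1).1 k3
  rw [← e1, ← e2]
  refine ⟨k3.2.1.toLp, ?_, ?_⟩
  · convert k4 using 1
    exact Lp.ext (g1.symm.trans k3.1.coeFn_toLp.symm)
  · rw [← Lp.coeFn_le]
    have g4 := (Lp.coeFn_nonneg _).2 (hΓ.nonneg k1.toGraph)
    rw [hΓ.comm] at g3
    filter_upwards [d3, g1, g2, g3, g4, k3.2.1.coeFn_toLp,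
      Lp.coeFn_smul ρ (Γ k1.toGraph k1.toGraph),
      Lp.coeFn_sub k3.2.1.toLp ((2 : ℝ) • Γ k2.toGraph k1.toGraph),
      Lp.coeFn_smul (2 : ℝ) (Γ k2.toGraph k1.toGraph)] with x a1 a2 a3 a4 a5 a6 a7 a8 a9
    rw [a7, a8, Pi.sub_apply, a9, a6, Pi.smul_apply, Pi.smul_apply, smul_eq_mul, smul_eq_mul]
    rw [gamma2, a2, a3, a4] at a1
    have a5' : 0 ≤ Γ k1.toGraph k1.toGraph x := a5
    -- Since `2 Γ₂(f) = L Γ(f) - 2 Γ(L f, f)`, the hypothesis gives `2 ρ Γ` as a lower bound. It is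
    -- weakened to `ρ Γ`, using `ρ ≥ 0` and `Γ ≥ 0`.
    nlinarith

/-- The reverse local Poincaré inequality, tested against a positive functional. -/
theorem IsCarreDuChamp.curvTime_mul_le (hΓ : S.IsCarreDuChamp Γ) {ρ : ℝ} (hρ : 0 ≤ ρ)
    (hcurv : S.CurvatureBoundedBelow ρ)
    {ℓ : Lp ℝ 1 μ →L[ℝ] ℝ} (hℓ : ∀ F, 0 ≤ F → 0 ≤ ℓ F) (t : ℝ≥0) (q : S.graph) :
    curvTime ρ t * ℓ (Γ (S.graphAct t q) (S.graphAct t q)) ≤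
      ℓ (S.l1.T t (prodL μ q.1.1 q.1.1)) - ℓ (prodL μ (S.l2.T t q.1.1) (S.l2.T t q.1.1)) := by
  obtain ⟨N, hN, hcore, hΓ2⟩ := hcurv
  -- Both sides are continuous in the graph norm, and the nice functions are dense for it.
  refine isClosed_property (p := fun q : S.graph => curvTime ρ t *
    ℓ (Γ (S.graphAct t q) (S.graphAct t q)) ≤ ℓ (S.l1.T t (prodL μ q.1.1 q.1.1)) -
      ℓ (prodL μ (S.l2.T t q.1.1) (S.l2.T t q.1.1)))
    (dense_toGraph hcore).denseRange_val ?_ ?_ q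
  · have c1 : Continuous fun q : S.graph => Γ (S.graphAct t q) (S.graphAct t q) :=
      (Γ.continuous.comp (S.graphAct t).continuous).clm_apply (S.graphAct t).continuous
    have c2 : Continuous fun q : S.graph => q.1.1 := continuous_fst.comp continuous_subtype_val
    have c3 : Continuous fun q : S.graph => S.l2.T t q.1.1 := (S.l2.T t).continuous.comp c2
    have c4 := continuous_apply_prodL (ℓ.comp (S.l1.T t)) c2 c2
    have c5 := continuous_apply_prodL ℓ c3 c3
    exact isClosed_le (continuous_const.mul (ℓ.continuous.comp c1)) (c4.sub c5)
  · rintro ⟨_, f, hf, g, hfg, rfl⟩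
    have h1 := S.hasGen_gen (hΓ2 f hf).1
    have hg : S.gen 2 f =ᵐ[μ] g := S.gen_two_ae hfg
    exact hΓ.curvTime_mul_le_of_orbit (q := hfg.toGraph) (r := h1.toGraph)
      (MemLp.toLp_congr h1.1 hfg.2.1 hg) (fun u => hΓ.exists_gen_orbit hρ hfg h1 u
        (hcore.1 _ (hN u f hf)) (hΓ2 _ (hN u f hf)).1 (hΓ2 _ (hN u f hf)).2.1
        (hΓ2 _ (hN u f hf)).2.2) hℓ t

end MarkovSemigroup

/-! ### Variance of `P_t g` under a measure with a weak Poincaré inequality. -/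

theorem osc_sq_le {ι : Type*} [Nonempty ι] {p : ι → ℝ} (hp1 : ∀ x, |p x| ≤ 1) : osc p ^ 2 ≤ 4 := by
  obtain ⟨x⟩ := ‹Nonempty ι›
  have hA : BddAbove (range p) := ⟨1, by rintro _ ⟨y, rfl⟩; exact (abs_le.1 (hp1 y)).2⟩
  have hB : BddBelow (range p) := ⟨-1, by rintro _ ⟨y, rfl⟩; exact (abs_le.1 (hp1 y)).1⟩
  have : Nonempty ι := ⟨x⟩
  have h1 : ⨆ x, p x ≤ 1 := ciSup_le fun y => (abs_le.1 (hp1 y)).2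
  have h2 : -1 ≤ ⨅ x, p x := le_ciInf fun y => (abs_le.1 (hp1 y)).1
  have h3 := (ciInf_le hB x).trans (le_ciSup hA x)
  have h4 : osc p ≤ 2 := by rw [osc]; linarith
  have h5 : 0 ≤ osc p := by rw [osc]; linarith
  nlinarith

/-- The energy has been eliminated, so only `L²`-continuous quantities remain. The first bound is
multiplied by `c` and is void when `b = c = 0`; the second condition covers `b = 0`. -/
theorem isClosed_variance_bound {X : Type*} [TopologicalSpace X] {Q R : X → ℝ}
    (hQ : Continuous Q) (hR : Continuous R) (c b m s : ℝ) :
    IsClosed {a | (c * (Q a - R a ^ 2 / m) ≤ b * (m - Q a) + 4 * s * c) ∧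
      (b = 0 → Q a - R a ^ 2 / m ≤ 4 * s)} := by
  have h1 : IsClosed {a | c * (Q a - R a ^ 2 / m) ≤ b * (m - Q a) + 4 * s * c} :=
    isClosed_le (by fun_prop) (by fun_prop)
  have h2 : IsClosed {a | Q a - R a ^ 2 / m ≤ 4 * s} := isClosed_le (by fun_prop) (by fun_prop)
  rcases eq_or_ne b 0 with rfl | hb
  · simp only [true_imp_iff]
    exact h1.inter h2
  · simpa [hb] using h1

section Density

variable {E : Type*} [MeasurableSpace E] {μ : Measure E}

theorem integral_densityMeasure {k : E → ℝ} (hk : Measurable k) (hk0 : ∀ᵐ x ∂μ, 0 ≤ k x)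
    (F : E → ℝ) : ∫ x, F x ∂(densityMeasure μ k) = ∫ x, k x * F x ∂μ := by
  rw [densityMeasure, integral_withDensity_eq_integral_toReal_smul (by fun_prop)
    (Eventually.of_forall fun _ => ENNReal.ofReal_lt_top)]
  refine integral_congr_ae ?_
  filter_upwards [hk0] with x hx
  rw [ENNReal.toReal_ofReal hx, smul_eq_mul]

theorem isFiniteMeasure_densityMeasure {k : E → ℝ} (hk : Integrable k μ) :
    IsFiniteMeasure (densityMeasure μ k) :=
  isFiniteMeasure_withDensity_ofReal hk.2

theorem integrable_mul_of_abs_le_one {k p : E → ℝ} (hk : Integrable k μ) (hp : Measurable p)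
    (hp1 : ∀ x, |p x| ≤ 1) : Integrable (fun x => k x * p x) μ :=
  hk.mul_bdd (c := 1) hp.aestronglyMeasurable (Eventually.of_forall hp1)

theorem integrable_mul_sq_of_abs_le_one {k p : E → ℝ} (hk : Integrable k μ) (hp : Measurable p)
    (hp1 : ∀ x, |p x| ≤ 1) : Integrable (fun x => k x * p x ^ 2) μ :=
  integrable_mul_of_abs_le_one hk (hp.pow_const 2) fun x => by
    rw [abs_pow]
    exact pow_le_one₀ (abs_nonneg _) (hp1 x)

theorem integral_mul_sub_sq {k p : E → ℝ} (hk : Integrable k μ) (hp : Measurable p)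
    (hp1 : ∀ x, |p x| ≤ 1) (b : ℝ) : ∫ x, k x * (p x - b) ^ 2 ∂μ =
      ∫ x, k x * p x ^ 2 ∂μ - 2 * b * ∫ x, k x * p x ∂μ + b ^ 2 * ∫ x, k x ∂μ := by
  have h1 := integrable_mul_of_abs_le_one hk hp hp1
  have h2 := integrable_mul_sq_of_abs_le_one hk hp hp1
  have h3 : Integrable (fun x => k x * p x ^ 2 - 2 * b * (k x * p x)) μ := h2.sub (h1.const_mul _)
  rw [← integral_const_mul, ← integral_const_mul, ← integral_sub h2 (h1.const_mul _),
    ← integral_add h3 (hk.const_mul _)]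
  refine integral_congr_ae (Eventually.of_forall fun x => ?_)
  simp only
  ring

theorem varOf_densityMeasure {k p : E → ℝ} (hk : Measurable k) (hk0 : ∀ᵐ x ∂μ, 0 ≤ k x)
    (hki : Integrable k μ) (hm : ∫ x, k x ∂μ ≠ 0) (hp : Measurable p) (hp1 : ∀ x, |p x| ≤ 1) :
    varOf (densityMeasure μ k) p =
      ∫ x, k x * p x ^ 2 ∂μ - (∫ x, k x * p x ∂μ) ^ 2 / ∫ x, k x ∂μ := by
  have := isFiniteMeasure_densityMeasure hki
  have hmass : (densityMeasure μ k).real univ = ∫ x, k x ∂μ := by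
    have := integral_densityMeasure hk hk0 (fun _ => 1)
    simpa using this
  rw [varOf, integral_densityMeasure hk hk0, average_eq, hmass, integral_densityMeasure hk hk0,
    integral_mul_sub_sq hki hp hp1, smul_eq_mul]
  field_simp
  ring

/-- Integration against a bounded nonnegative density, as a positive functional on `L¹(μ)`. -/
theorem exists_density_functional {k : E → ℝ} (hk : Measurable k) (hk0 : ∀ᵐ x ∂μ, 0 ≤ k x) {M : ℝ}
    (hkM : ∀ᵐ x ∂μ, k x ≤ M) : ∃ ℓ : Lp ℝ 1 μ →L[ℝ] ℝ, (∀ F, ℓ F = ∫ x, k x * F x ∂μ) ∧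
      ∀ F, 0 ≤ F → 0 ≤ ℓ F := by
  have hL : MemLp k ∞ μ := memLp_top_of_bound hk.aestronglyMeasurable M (by
    filter_upwards [hk0, hkM] with x h1 h2
    rwa [Real.norm_of_nonneg h1])
  let ℓ : Lp ℝ 1 μ →L[ℝ] ℝ := (ContinuousLinearMap.mul ℝ ℝ).lpPairing μ ∞ 1 hL.toLp
  have e : ∀ F, ℓ F = ∫ x, k x * F x ∂μ := by
    intro F
    refine (ContinuousLinearMap.lpPairing_eq_integral _ _ _).trans (integral_congr_ae ?_)
    filter_upwards [hL.coeFn_toLp] with x hx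
    rw [hx]
    rfl
  refine ⟨ℓ, e, fun F hF => ?_⟩
  rw [e]
  refine integral_nonneg_of_ae ?_
  filter_upwards [hk0, (Lp.coeFn_nonneg F).2 hF] with x h1 h2
  exact mul_nonneg h1 h2

end Density

namespace MarkovSemigroup

variable {E : Type*} [MeasurableSpace E] {μ : Measure E} {S : MarkovSemigroup μ}

theorem abs_act_le_one (t : ℝ≥0) {v : E → ℝ} (hv : ∀ x, |v x| ≤ 1) (x : E) :
    |S.act t v x| ≤ 1 := by
  have := norm_integral_le_of_norm_le_const (μ := S.P t x) (f := v) (C := 1)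
    (Eventually.of_forall hv)
  simpa [act] using this

variable [IsProbabilityMeasure μ]

theorem memLp_two_of_abs_le_one {v : E → ℝ} (hv : Measurable v) (hv1 : ∀ x, |v x| ≤ 1) :
    MemLp v 2 μ :=
  (memLp_top_of_bound hv.aestronglyMeasurable 1 (Eventually.of_forall hv1)).mono_exponent le_top

/-- Functions with values in `[-1, 1]` are limits of functions of the domain with values in
`[-1, 1]`. -/
theorem mem_closure_dom {g : E → ℝ} (hg : Measurable g) (hg1 : ∀ x, |g x| ≤ 1) :
    (memLp_two_of_abs_le_one (μ := μ) hg hg1).toLp ∈ closure {a : Lp ℝ 2 μ | ∃ v : E → ℝ,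
      Measurable v ∧ (∀ x, |v x| ≤ 1) ∧ S.Dom 2 v ∧ v =ᵐ[μ] a} := by
  set a := (memLp_two_of_abs_le_one (μ := μ) hg hg1).toLp
  let K : Set (Lp ℝ 2 μ) := {a | ∀ᵐ x ∂μ, |a x| ≤ 1}
  have hKc : IsClosed K := by
    let c : Lp ℝ 2 μ := (memLp_const (1 : ℝ)).toLp
    have : K = {a | |a| ≤ c} := by
      ext b
      simp only [K, mem_ofPred_eq]
      rw [← Lp.coeFn_le]
      refine eventually_congr ?_
      filter_upwards [Lp.coeFn_abs b, (memLp_const (1 : ℝ)).coeFn_toLp (μ := μ) (p := 2)]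
        with x h1 h2
      rw [h1, h2]
    rw [this]
    exact isClosed_le (continuous_id.sup continuous_neg) continuous_const
  have hKconv : Convex ℝ K := by
    intro x hx y hy r s hr hs hrs
    filter_upwards [hx, hy, Lp.coeFn_add (r • x) (s • y), Lp.coeFn_smul r x, Lp.coeFn_smul s y]
      with z h1 h2 h3 h4 h5
    rw [h3, Pi.add_apply, h4, h5, Pi.smul_apply, Pi.smul_apply, smul_eq_mul, smul_eq_mul]
    rw [abs_le] at *
    constructor <;> nlinarith
  have hTK : ∀ t, S.l2.T t a ∈ K := by
    intro t
    filter_upwards [S.coeFn_lpAct ENNReal.ofNat_ne_top t a,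
      S.act_congr t (memLp_two_of_abs_le_one (μ := μ) hg hg1).coeFn_toLp] with x h1 h2
    change |S.lpAct 2 ENNReal.ofNat_ne_top t a x| ≤ 1
    rw [h1, h2]
    exact abs_act_le_one t hg1 x
  refine mem_closure_of_tendsto (S.l2.tendsto_average a) ?_
  filter_upwards [self_mem_nhdsWithin] with e he
  have he : 0 < e := he
  set b := e⁻¹ • ∫ s in (0 : ℝ)..e, S.l2.T s.toNNReal a with hb
  have hbK : b ∈ K := by
    -- The orbit stays in the closed convex set `K`, hence so does its time average.
    have hi := ((S.l2.continuous_orbit_real a).intervalIntegrable (μ := volume) 0 e).1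
    have := hKconv.set_average_mem hKc (by simp [he]) (by simp)
      (Eventually.of_forall fun s : ℝ => hTK s.toNNReal) hi
    convert this using 1
    rw [hb, setAverage_eq, intervalIntegral.integral_of_le he.le]
    simp [he.le]
  have hG := (S.l2.gen_integral a he.le).smul e⁻¹
  have hH : S.HasGen 2 b (e⁻¹ • (S.l2.T e.toNNReal a - a) : Lp ℝ 2 μ) := by
    rw [S.hasGen_two_iff (Lp.memLp _) (Lp.memLp _), Lp.toLp_coeFn, Lp.toLp_coeFn]
    exact hG
  -- The weak Poincaré inequality sees oscillations at every point, so a version bounded everywhere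
  -- is chosen.
  have hv : (fun x => max (-1) (min 1 (b x))) =ᵐ[μ] b := by
    filter_upwards [hbK] with x hx
    rw [abs_le] at hx
    rw [min_eq_right hx.2, max_eq_right hx.1]
  refine ⟨fun x => max (-1) (min 1 (b x)), ?_, fun x => ?_,
    ⟨_, S.hasGen_congr hH hv.symm EventuallyEq.rfl⟩, hv⟩
  · exact measurable_const.max (measurable_const.min (Lp.stronglyMeasurable b).measurable)
  · rw [abs_le]
    exact ⟨le_max_left _ _, max_le (by norm_num) (min_le_left _ _)⟩

/-- The weak Poincaré inequality for `P_t v` combined with the reverse local Poincaré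
inequality, for `v` in the domain. -/
theorem WeakPoincare.act_of_dom {A : Subalgebra ℝ (E → ℝ)} (hA : S.IsDiffusionAlgebra A)
    {ρ : ℝ} (hρ : 0 ≤ ρ) (hcurv : S.CurvatureBoundedBelow ρ) {k : E → ℝ} (hk : Measurable k)
    (hk0 : ∀ᵐ x ∂μ, 0 ≤ k x) {M : ℝ} (hkM : ∀ᵐ x ∂μ, k x ≤ M) (hm : ∫ x, k x ∂μ ≠ 0)
    {β : ℝ → ℝ} (hW : S.WeakPoincare (densityMeasure μ k) β) {s : ℝ} (hs : 0 < s) (t : ℝ≥0)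
    {v : E → ℝ} (hv : Measurable v) (hv1 : ∀ x, |v x| ≤ 1) (hvD : S.Dom 2 v) :
    ∃ γ, 0 ≤ γ ∧ curvTime ρ t * γ ≤ ∫ x, k x ∂μ - ∫ x, k x * S.act t v x ^ 2 ∂μ ∧
      ∫ x, k x * S.act t v x ^ 2 ∂μ - (∫ x, k x * S.act t v x ∂μ) ^ 2 / ∫ x, k x ∂μ ≤
        β s * γ + 4 * s := by
  obtain ⟨Γ, hΓ⟩ := hA.exists_carreDuChamp
  have hΓ : S.IsCarreDuChamp Γ := hΓ
  obtain ⟨ℓ, hℓ, hℓ0⟩ := exists_density_functional hk hk0 hkM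
  have hki : Integrable k μ := by
    refine Integrable.of_bound hk.aestronglyMeasurable M ?_
    filter_upwards [hk0, hkM] with x h1 h2
    rwa [Real.norm_of_nonneg h1]
  obtain ⟨w, hvw⟩ := hvD
  have hv2 : MemLp v 2 μ := hvw.1
  have hp := S.measurable_act t hv
  have hp1 := abs_act_le_one (S := S) t hv1
  have hpD := S.hasGen_two_act hvw t
  have key := hΓ.curvTime_mul_le hρ hcurv hℓ0 t hvw.toGraph
  rw [← toGraph_act] at key
  have e1 : ℓ (Γ hpD.toGraph hpD.toGraph) =
      ∫ x, S.gamma (S.act t v) (S.act t v) x ∂(densityMeasure μ k) := by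
    rw [hℓ, integral_densityMeasure hk hk0]
    refine integral_congr_ae ?_
    filter_upwards [hΓ.gamma_ae hpD hpD] with x hx
    rw [hx]
  have e2 : ℓ (S.l1.T t (prodL μ hvw.toGraph.1.1 hvw.toGraph.1.1)) ≤ ∫ x, k x ∂μ := by
    rw [hℓ]
    have hsq : prodL μ hvw.toGraph.1.1 hvw.toGraph.1.1 =ᵐ[μ] fun x => v x * v x := by
      filter_upwards [Lp.coeFn_prodL hvw.toGraph.1.1 hvw.toGraph.1.1, hv2.coeFn_toLp]
        with x h1 h2
      rw [h1]
      change (hv2.toLp v) x * (hv2.toLp v) x = _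
      rw [h2]
    have hle : ∀ᵐ x ∂μ, k x * S.l1.T t (prodL μ hvw.toGraph.1.1 hvw.toGraph.1.1) x ≤ k x ∧
        0 ≤ k x * S.l1.T t (prodL μ hvw.toGraph.1.1 hvw.toGraph.1.1) x := by
      filter_upwards [hk0, S.coeFn_lpAct ENNReal.one_ne_top t
        (prodL μ hvw.toGraph.1.1 hvw.toGraph.1.1), S.act_congr t hsq] with x h0 h1 h2
      change k x * S.lpAct 1 ENNReal.one_ne_top t _ x ≤ k x ∧
        0 ≤ k x * S.lpAct 1 ENNReal.one_ne_top t _ x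
      rw [h1, h2]
      have h3 : ∀ y, |v y * v y| ≤ 1 := fun y => by
        rw [abs_mul]
        exact mul_le_one₀ (hv1 y) (abs_nonneg _) (hv1 y)
      have h4 := (abs_le.1 (abs_act_le_one (S := S) t h3 x)).2
      have h5 : 0 ≤ S.act t (fun y => v y * v y) x := integral_nonneg fun y => mul_self_nonneg _
      exact ⟨mul_le_of_le_one_right h0 h4, mul_nonneg h0 h5⟩
    exact integral_mono_of_nonneg (hle.mono fun x h => h.2) hki (hle.mono fun x h => h.1)
  have e3 : ℓ (prodL μ (S.l2.T t hvw.toGraph.1.1) (S.l2.T t hvw.toGraph.1.1)) =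
      ∫ x, k x * S.act t v x ^ 2 ∂μ := by
    rw [hℓ]
    refine integral_congr_ae ?_
    filter_upwards [Lp.coeFn_prodL (S.l2.T t hvw.toGraph.1.1) (S.l2.T t hvw.toGraph.1.1),
      S.coeFn_lpAct ENNReal.ofNat_ne_top t (hv2.toLp v), S.act_congr t hv2.coeFn_toLp]
      with x h1 h2 h3
    rw [h1]
    change k x * (S.lpAct 2 ENNReal.ofNat_ne_top t (hv2.toLp v) x *
      S.lpAct 2 ENNReal.ofNat_ne_top t (hv2.toLp v) x) = _
    rw [h2, h3, sq]
  -- `γ` is the energy `∫ Γ(P_t v) k dμ`.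
  refine ⟨_, hℓ0 _ (hΓ.nonneg hpD.toGraph), ?_, ?_⟩
  · rw [e3] at key
    linarith
  · have : Nonempty E := nonempty_of_isProbabilityMeasure μ
    rw [← varOf_densityMeasure hk hk0 hki hm hp hp1, e1]
    refine (hW.2.2 s hs _ hp ⟨1, hp1⟩ ⟨_, hpD⟩).trans ?_
    have := osc_sq_le hp1
    nlinarith

/-- The variance of `P_t g` under a measure with a weak Poincaré inequality. -/
theorem WeakPoincare.act {A : Subalgebra ℝ (E → ℝ)} (hA : S.IsDiffusionAlgebra A)
    {ρ : ℝ} (hρ : 0 ≤ ρ) (hcurv : S.CurvatureBoundedBelow ρ) {k : E → ℝ} (hk : Measurable k)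
    (hk0 : ∀ᵐ x ∂μ, 0 ≤ k x) {M : ℝ} (hkM : ∀ᵐ x ∂μ, k x ≤ M) (hm : ∫ x, k x ∂μ ≠ 0)
    {β : ℝ → ℝ} (hW : S.WeakPoincare (densityMeasure μ k) β) {s : ℝ} (hs : 0 < s) (t : ℝ≥0)
    {g : E → ℝ} (hg : Measurable g) (hg1 : ∀ x, |g x| ≤ 1) :
    (curvTime ρ t * (∫ x, k x * S.act t g x ^ 2 ∂μ -
        (∫ x, k x * S.act t g x ∂μ) ^ 2 / ∫ x, k x ∂μ) ≤
      β s * (∫ x, k x ∂μ - ∫ x, k x * S.act t g x ^ 2 ∂μ) + 4 * s * curvTime ρ t) ∧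
    (β s = 0 → ∫ x, k x * S.act t g x ^ 2 ∂μ -
      (∫ x, k x * S.act t g x ∂μ) ^ 2 / ∫ x, k x ∂μ ≤ 4 * s) := by
  obtain ⟨ℓ, hℓ, hℓ0⟩ := exists_density_functional hk hk0 hkM
  let one : Lp ℝ 2 μ := (memLp_const (1 : ℝ)).toLp
  let Q : Lp ℝ 2 μ → ℝ := fun a => ℓ (prodL μ (S.l2.T t a) (S.l2.T t a))
  let R : Lp ℝ 2 μ → ℝ := fun a => ℓ (prodL μ (S.l2.T t a) one)
  have hT : Continuous fun a => S.l2.T t a := (S.l2.T t).continuous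
  have hQ : Continuous Q := continuous_apply_prodL ℓ hT hT
  have hR : Continuous R := continuous_apply_prodL ℓ hT continuous_const
  have eT : ∀ (v : E → ℝ) (a : Lp ℝ 2 μ), v =ᵐ[μ] a → S.l2.T t a =ᵐ[μ] S.act t v := fun v a h =>
    (S.coeFn_lpAct ENNReal.ofNat_ne_top t a).trans (S.act_congr t h.symm)
  have eQ : ∀ (v : E → ℝ) (a : Lp ℝ 2 μ), v =ᵐ[μ] a → Q a = ∫ x, k x * S.act t v x ^ 2 ∂μ := by
    intro v a h
    change ℓ (prodL μ (S.l2.T t a) (S.l2.T t a)) = _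
    rw [hℓ]
    refine integral_congr_ae ?_
    filter_upwards [Lp.coeFn_prodL (S.l2.T t a) (S.l2.T t a), eT v a h] with x h1 h2
    rw [h1, h2, sq]
  have eR : ∀ (v : E → ℝ) (a : Lp ℝ 2 μ), v =ᵐ[μ] a → R a = ∫ x, k x * S.act t v x ∂μ := by
    intro v a h
    change ℓ (prodL μ (S.l2.T t a) one) = _
    rw [hℓ]
    refine integral_congr_ae ?_
    filter_upwards [Lp.coeFn_prodL (S.l2.T t a) one, eT v a h,
      (memLp_const (1 : ℝ)).coeFn_toLp (μ := μ) (p := 2)] with x h1 h2 h3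
    rw [h1, h2, h3, mul_one]
  set m := ∫ x, k x ∂μ
  let Z : Set (Lp ℝ 2 μ) := {a | (curvTime ρ t * (Q a - R a ^ 2 / m) ≤
    β s * (m - Q a) + 4 * s * curvTime ρ t) ∧ (β s = 0 → Q a - R a ^ 2 / m ≤ 4 * s)}
  have hZ : IsClosed Z := isClosed_variance_bound hQ hR _ _ _ _
  have hsub := closure_minimal (s := {a : Lp ℝ 2 μ | ∃ v : E → ℝ,
      Measurable v ∧ (∀ x, |v x| ≤ 1) ∧ S.Dom 2 v ∧ v =ᵐ[μ] a}) (t := Z) ?_ hZ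
  · have := hsub (mem_closure_dom (S := S) (μ := μ) hg hg1)
    have hgg := (memLp_two_of_abs_le_one (μ := μ) hg hg1).coeFn_toLp.symm
    simp only [Z, mem_ofPred_eq] at this
    rwa [eQ _ _ hgg, eR _ _ hgg] at this
  · rintro a ⟨v, hv, hv1, hvD, hva⟩
    obtain ⟨γ, h0, h1, h2⟩ := hW.act_of_dom hA hρ hcurv hk hk0 hkM hm hs t hv hv1 hvD
    simp only [Z, mem_ofPred_eq]
    rw [eQ _ _ hva, eR _ _ hva]
    have hc : 0 ≤ curvTime ρ t := curvTime_nonneg hρ t.coe_nonneg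
    have hβ := hW.2.1 s hs
    constructor
    -- Multiply the variance bound by `curvTime ρ t` and the energy bound by `β s`; the terms with
    -- `γ` cancel.
    · nlinarith
    · intro hβ0
      rw [hβ0] at h2
      linarith

end MarkovSemigroup

/-! ### From variances to total variation. -/

theorem curvRate_eq (ρ t b : ℝ) : curvRate ρ t b = b / (curvTime ρ t + b) := by
  rw [curvRate, curvTime]
  split_ifs with h
  · rfl
  · rw [div_add' _ _ _ h, div_div_eq_mul_div]
    congr 1 <;> ring

/-- Once `e^{ρ t} ≥ 2`, the denominator is at least `e^{ρ t} / 2`. -/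
theorem curvRate_le_of_two_le {ρ t b : ℝ} (hρ : 0 < ρ) (hb : 0 ≤ b)
    (hu : 2 ≤ Real.exp (ρ * t)) : curvRate ρ t b ≤ 2 * (ρ * b) / Real.exp (ρ * t) := by
  rw [curvRate, if_neg hρ.ne']
  have h1 : 0 ≤ ρ * b := by positivity
  rw [div_le_div_iff₀ (by linarith) (by positivity)]
  nlinarith

section TotalVariation

variable {E : Type*} [MeasurableSpace E] {μ : Measure E}

theorem tvDist_le_two {ν : Measure E} [IsProbabilityMeasure ν] [IsProbabilityMeasure μ] :
    tvDist ν μ ≤ 2 := by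
  have : Nonempty {B : Set E // MeasurableSet B} := ⟨⟨∅, MeasurableSet.empty⟩⟩
  have : ⨆ B : {B : Set E // MeasurableSet B}, |ν.real B - μ.real B| ≤ 1 := ciSup_le fun B => by
    have h1 := measureReal_le_one (μ := ν) (s := B.1)
    have h2 := measureReal_le_one (μ := μ) (s := B.1)
    have h3 := measureReal_nonneg (μ := ν) (s := B.1)
    have h4 := measureReal_nonneg (μ := μ) (s := B.1)
    rw [abs_le]
    constructor <;> linarith
  rw [tvDist]
  linarith

theorem tvDist_le_two_mul_sqrt {ν : Measure E} {x : ℝ}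
    (h : ∀ B, MeasurableSet B → (ν.real B - μ.real B) ^ 2 ≤ x) : tvDist ν μ ≤ 2 * √x := by
  have : Nonempty {B : Set E // MeasurableSet B} := ⟨⟨∅, MeasurableSet.empty⟩⟩
  rw [tvDist]
  gcongr
  exact ciSup_le fun B => Real.abs_le_sqrt (h B.1 B.2)

theorem isProbabilityMeasure_densityMeasure {h : E → ℝ} (hh : IsProbDensity μ h) :
    IsProbabilityMeasure (densityMeasure μ h) := by
  refine ⟨?_⟩
  rw [densityMeasure, withDensity_apply _ MeasurableSet.univ, Measure.restrict_univ,
    ← ofReal_integral_eq_lintegral_ofReal hh.2.2.1 hh.2.1, hh.2.2.2, ENNReal.ofReal_one]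

/-- The Cauchy-Schwarz bound of `∫ p (h - 1) dμ` by the variance of `p` under the measure
`((1 + h) / 2) μ`. -/
theorem sq_integral_mul_sub_one_le [IsProbabilityMeasure μ] {h p : E → ℝ}
    (hh : IsProbDensity μ h) (hp : Measurable p) (hp1 : ∀ x, |p x| ≤ 1) :
    (∫ x, (h x - 1) * p x ∂μ) ^ 2 ≤ 4 * (∫ x, (1 + h x) / 2 * p x ^ 2 ∂μ -
      (∫ x, (1 + h x) / 2 * p x ∂μ) ^ 2) := by
  obtain ⟨hm, h0, hi, h1⟩ := hh
  set k : E → ℝ := fun x => (1 + h x) / 2 with hk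
  have hki : Integrable k μ := ((integrable_const 1).add hi).div_const 2
  have hk1 : ∫ x, k x ∂μ = 1 := by
    simp only [hk]
    rw [integral_div, integral_add (integrable_const 1) hi, h1]
    simp
  set b := ∫ x, k x * p x ∂μ
  have hd : Integrable (fun x => h x - 1) μ := hi.sub (integrable_const 1)
  have hcent : ∫ x, (h x - 1) * p x ∂μ = ∫ x, (h x - 1) * (p x - b) ∂μ := by
    have e : ∫ x, (h x - 1) * b ∂μ = 0 := by
      rw [integral_mul_const, integral_sub hi (integrable_const 1), h1]
      simp
    have : ∫ x, (h x - 1) * (p x - b) ∂μ =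
        ∫ x, (h x - 1) * p x ∂μ - ∫ x, (h x - 1) * b ∂μ := by
      rw [← integral_sub (integrable_mul_of_abs_le_one hd hp hp1) (hd.mul_const b)]
      simp only [mul_sub]
    rw [this, e, sub_zero]
  have hsq := integral_mul_sub_sq hki hp hp1 b
  rw [hk1] at hsq
  have hV : ∫ x, k x * (p x - b) ^ 2 ∂μ = ∫ x, k x * p x ^ 2 ∂μ - b ^ 2 := by
    rw [hsq]; ring
  have hkp : Integrable (fun x => k x * |p x - b|) μ := by
    have : Integrable (fun x => k x * (p x - b)) μ := by
      simp only [mul_sub]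
      exact (integrable_mul_of_abs_le_one hki hp hp1).sub (hki.mul_const b)
    refine this.abs.congr ?_
    filter_upwards [h0] with x hx
    rw [abs_mul, abs_of_nonneg]
    simp only [hk]
    linarith
  have hkp2 : Integrable (fun x => k x * (p x - b) ^ 2) μ := by
    have : Integrable (fun x => k x * p x ^ 2 - 2 * b * (k x * p x) + b ^ 2 * k x) μ :=
      ((integrable_mul_sq_of_abs_le_one hki hp hp1).sub
        ((integrable_mul_of_abs_le_one hki hp hp1).const_mul _)).add (hki.const_mul _)
    refine this.congr (Eventually.of_forall fun x => ?_)
    simp only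
    ring
  set a := ∫ x, k x * |p x - b| ∂μ
  -- Cauchy-Schwarz for the probability density `k`, by expanding `∫ k (|p - b| - a)² dμ ≥ 0`.
  have ha : a ^ 2 ≤ ∫ x, k x * (p x - b) ^ 2 ∂μ := by
    have hi1 : Integrable (fun x => k x * (p x - b) ^ 2 - 2 * a * (k x * |p x - b|)) μ :=
      hkp2.sub (hkp.const_mul _)
    have h2 : 0 ≤ ∫ x, (k x * (p x - b) ^ 2 - 2 * a * (k x * |p x - b|) + a ^ 2 * k x) ∂μ := by
      refine integral_nonneg_of_ae ?_
      filter_upwards [h0] with x hx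
      have hkx : 0 ≤ k x := by simp only [hk]; linarith
      have : k x * (p x - b) ^ 2 - 2 * a * (k x * |p x - b|) + a ^ 2 * k x
          = k x * (|p x - b| - a) ^ 2 := by
        rw [← sq_abs (p x - b)]; ring
      rw [this]
      exact mul_nonneg hkx (sq_nonneg _)
    rw [integral_add hi1 (hki.const_mul _), integral_sub hkp2 (hkp.const_mul _),
      integral_const_mul, integral_const_mul, hk1] at h2
    nlinarith
  -- Here `|h - 1| ≤ 1 + h = 2 k`.
  have habs : |∫ x, (h x - 1) * (p x - b) ∂μ| ≤ 2 * a := by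
    rw [← integral_const_mul]
    refine (abs_integral_le_integral_abs).trans (integral_mono_of_nonneg
      (Eventually.of_forall fun x => abs_nonneg _) (hkp.const_mul 2) ?_)
    filter_upwards [h0] with x hx
    rw [abs_mul, ← mul_assoc]
    gcongr
    rw [abs_le]
    simp only [hk]
    constructor <;> linarith
  rw [hcent, ← hV]
  calc (∫ x, (h x - 1) * (p x - b) ∂μ) ^ 2 ≤ (2 * a) ^ 2 :=
        sq_le_sq' (abs_le.1 habs).1 (abs_le.1 habs).2
    _ ≤ _ := by linarith [ha, (by ring : (2 * a) ^ 2 = 4 * a ^ 2)]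

end TotalVariation

namespace MarkovSemigroup

variable {E : Type*} [MeasurableSpace E] {μ : Measure E} {S : MarkovSemigroup μ}

theorem WeakPoincareApprox.exists_weakPoincare {β : ℝ → ℝ} {h : E → ℝ}
    (hW : S.WeakPoincareApprox β h) : ∃ ν, S.WeakPoincare ν β := by
  obtain ⟨hn, _, he, _⟩ := hW
  obtain ⟨n, hn⟩ := he.exists
  exact ⟨_, hn.2⟩

theorem WeakPoincareApprox.antitoneOn {β : ℝ → ℝ} {h : E → ℝ}
    (hW : S.WeakPoincareApprox β h) : AntitoneOn β (Ioi 0) :=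
  hW.exists_weakPoincare.choose_spec.1

theorem WeakPoincareApprox.nonneg {β : ℝ → ℝ} {h : E → ℝ}
    (hW : S.WeakPoincareApprox β h) : ∀ s, 0 < s → 0 ≤ β s :=
  hW.exists_weakPoincare.choose_spec.2.1

theorem law_real {h : E → ℝ} (hh : IsProbDensity μ h) (t : ℝ≥0) {B : Set E}
    (hB : MeasurableSet B) : (S.law t (densityMeasure μ h)).real B =
      ∫ x, h x * S.act t (B.indicator 1) x ∂μ := by
  have e : ∀ x, S.act t (B.indicator 1) x = (S.P t x).real B := fun x => integral_indicator_one hB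
  simp_rw [e]
  rw [← integral_densityMeasure hh.1 hh.2.1, law, measureReal_def,
    Measure.bind_apply hB (S.P t).measurable.aemeasurable]
  rw [← integral_toReal ((S.P t).measurable_coe hB).aemeasurable
    (Eventually.of_forall fun x => measure_lt_top _ _)]
  rfl

variable [IsProbabilityMeasure μ]

/-- The variance of `P_t g` under the limit `((1 + h) / 2) μ` of measures with weak Poincaré
inequalities. -/
theorem WeakPoincareApprox.variance_act_le {A : Subalgebra ℝ (E → ℝ)}
    (hA : S.IsDiffusionAlgebra A) {ρ : ℝ} (hρ : 0 ≤ ρ) (hcurv : S.CurvatureBoundedBelow ρ)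
    {β : ℝ → ℝ} {h : E → ℝ} (hh : IsProbDensity μ h) (hW : S.WeakPoincareApprox β h)
    {s : ℝ} (hs : 0 < s) (t : ℝ≥0) {g : E → ℝ} (hg : Measurable g) (hg1 : ∀ x, |g x| ≤ 1) :
    ∫ x, (1 + h x) / 2 * S.act t g x ^ 2 ∂μ - (∫ x, (1 + h x) / 2 * S.act t g x ∂μ) ^ 2 ≤
      curvRate ρ t (β s) + 4 * s := by
  have hβ := hW.nonneg s hs
  obtain ⟨hn, hnm, hev, hlim⟩ := hW
  set p := S.act t g
  have hp : Measurable p := S.measurable_act t hg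
  have hp1 : ∀ x, |p x| ≤ 1 := abs_act_le_one t hg1
  have hk : Integrable (fun x => (1 + h x) / 2) μ :=
    ((integrable_const 1).add hh.2.2.1).div_const 2
  have hk1 : ∫ x, (1 + h x) / 2 ∂μ = 1 := by
    rw [integral_div, integral_add (integrable_const 1) hh.2.2.1, hh.2.2.2]
    simp
  have hni : ∀ᶠ n : ℕ in atTop, Integrable (hn n) μ := by
    filter_upwards [hev] with n hn'
    refine Integrable.of_bound (hnm n).aestronglyMeasurable n ?_
    filter_upwards [hn'.1] with x hx
    rw [Real.norm_of_nonneg (by linarith)]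
    exact hx.2
  -- `L¹` convergence of the densities suffices, as all test functions are bounded by `1`; the
  -- masses are the case `w = 1`.
  have hT : ∀ w : E → ℝ, Measurable w → (∀ x, |w x| ≤ 1) →
      Tendsto (fun n => ∫ x, hn n x * w x ∂μ) atTop (𝓝 (∫ x, (1 + h x) / 2 * w x ∂μ)) := by
    intro w hw hw1
    refine tendsto_integral_of_L1' _ (integrable_mul_of_abs_le_one hk hw hw1).aestronglyMeasurable
      (hni.mono fun n hi => integrable_mul_of_abs_le_one hi hw hw1) ?_
    refine tendsto_of_tendsto_of_tendsto_of_le_of_le tendsto_const_nhds hlim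
      (fun _ => zero_le) fun n => eLpNorm_mono fun x => ?_
    rw [Pi.sub_apply, ← sub_mul, norm_mul]
    exact mul_le_of_le_one_right (norm_nonneg _) (hw1 x)
  have t0 := hT (fun _ => 1) measurable_const (by simp)
  have t1 := hT p hp hp1
  have t2 := hT (fun x => p x ^ 2) (hp.pow_const 2) fun x => by
    rw [abs_pow]
    exact pow_le_one₀ (abs_nonneg _) (hp1 x)
  simp only [mul_one] at t0
  rw [hk1] at t0
  set a := ∫ x, (1 + h x) / 2 * p x ^ 2 ∂μ
  set b := ∫ x, (1 + h x) / 2 * p x ∂μ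
  have hV := t2.sub ((t1.pow 2).div t0 one_ne_zero)
  rw [div_one] at hV
  have hstep : ∀ᶠ n : ℕ in atTop,
      (curvTime ρ t * (∫ x, hn n x * p x ^ 2 ∂μ - (∫ x, hn n x * p x ∂μ) ^ 2 / ∫ x, hn n x ∂μ) ≤
        β s * (∫ x, hn n x ∂μ - ∫ x, hn n x * p x ^ 2 ∂μ) + 4 * s * curvTime ρ t) ∧
      (β s = 0 → ∫ x, hn n x * p x ^ 2 ∂μ -
        (∫ x, hn n x * p x ∂μ) ^ 2 / ∫ x, hn n x ∂μ ≤ 4 * s) := by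
    filter_upwards [hev, hni] with n hn' hi
    have hm : (1 / 2 : ℝ) ≤ ∫ x, hn n x ∂μ := by
      have := integral_mono_ae (integrable_const (1 / 2 : ℝ)) hi (hn'.1.mono fun x hx => hx.1)
      simpa using this
    exact hn'.2.act hA hρ hcurv (hnm n) (hn'.1.mono fun x hx => by linarith)
      (hn'.1.mono fun x hx => hx.2) (by linarith) hs t hg hg1
  have hc : 0 ≤ curvTime ρ t := curvTime_nonneg hρ t.coe_nonneg
  rcases hβ.eq_or_lt with h0 | h0
  · have := le_of_tendsto hV (hstep.mono fun n hn' => hn'.2 h0.symm)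
    rw [← h0, curvRate_eq, zero_div, zero_add]
    exact this
  · have h1 := le_of_tendsto_of_tendsto (hV.const_mul (curvTime ρ t))
      (((t0.sub t2).const_mul (β s)).add_const (4 * s * curvTime ρ t))
      (hstep.mono fun n hn' => hn'.1)
    have hpos : 0 < curvTime ρ t + β s := by linarith
    rw [curvRate_eq, div_add' _ _ _ hpos.ne', le_div_iff₀ hpos]
    -- With `V = a - b²`, the limit reads `c V ≤ β (1 - V - b²) + 4 s c`. Move `β V` to the left,
    -- drop `-β b²` and add `4 s β` on the right.
    nlinarith [mul_nonneg hβ (sq_nonneg b), mul_nonneg hs.le hβ]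

theorem WeakPoincareApprox.sq_law_sub_le {A : Subalgebra ℝ (E → ℝ)}
    (hA : S.IsDiffusionAlgebra A) {ρ : ℝ} (hρ : 0 ≤ ρ) (hcurv : S.CurvatureBoundedBelow ρ)
    {β : ℝ → ℝ} {h : E → ℝ} (hh : IsProbDensity μ h) (hW : S.WeakPoincareApprox β h)
    {s : ℝ} (hs : 0 < s) (t : ℝ≥0) {B : Set E} (hB : MeasurableSet B) :
    ((S.law t (densityMeasure μ h)).real B - μ.real B) ^ 2 ≤ curvRate ρ t (β s) + 4 * s := by
  set f : E → ℝ := B.indicator 1 with hf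
  have hfm : Measurable f := measurable_one.indicator hB
  have hf01 : ∀ x, 0 ≤ f x ∧ f x ≤ 1 := fun x => by
    by_cases hx : x ∈ B <;> simp [hf, hx]
  have hf1 : ∀ x, |f x| ≤ 1 := fun x => by
    rw [abs_of_nonneg (hf01 x).1]
    exact (hf01 x).2
  -- The indicator is recentred to fill `[-1, 1]`. The factor `2` cancels the `4` from the
  -- Cauchy-Schwarz bound.
  let g : E → ℝ := fun x => 2 * f x - 1
  have hg : Measurable g := (hfm.const_mul 2).sub_const 1
  have hg1 : ∀ x, |g x| ≤ 1 := fun x => by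
    rw [abs_le]
    have := hf01 x
    constructor <;> simp only [g] <;> linarith
  have hgf : ∀ x, S.act t g x = 2 * S.act t f x - 1 := fun x => by
    have hi : Integrable f (S.P t x) :=
      Integrable.of_bound hfm.aestronglyMeasurable 1 (Eventually.of_forall hf1)
    change ∫ y, (2 * f y - 1) ∂(S.P t x) = 2 * ∫ y, f y ∂(S.P t x) - 1
    rw [integral_sub (hi.const_mul 2) (integrable_const 1), integral_const_mul]
    simp
  have hp := S.measurable_act t hfm
  have hp1 := abs_act_le_one (S := S) t hf1
  have hi1 := integrable_mul_of_abs_le_one hh.2.2.1 hp hp1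
  have hi2 : Integrable (S.act t f) μ :=
    Integrable.of_bound hp.aestronglyMeasurable 1 (Eventually.of_forall hp1)
  have hμB : μ.real B = ∫ x, S.act t f x ∂μ := by
    rw [S.integral_act t (Integrable.of_bound hfm.aestronglyMeasurable 1 (Eventually.of_forall hf1)),
      hf, integral_indicator_one hB]
  have e : 2 * ((S.law t (densityMeasure μ h)).real B - μ.real B) =
      ∫ x, (h x - 1) * S.act t g x ∂μ := by
    have hi3 : Integrable (fun x => h x - 1) μ := hh.2.2.1.sub (integrable_const 1)
    have hi4 : Integrable (fun x => h x * S.act t f x - S.act t f x) μ := hi1.sub hi2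
    have e0 : ∫ x, (h x - 1) ∂μ = 0 := by
      rw [integral_sub hh.2.2.1 (integrable_const 1), hh.2.2.2]
      simp
    rw [law_real hh t hB, hμB, ← integral_sub hi1 hi2, ← integral_const_mul]
    rw [← sub_zero (∫ x, 2 * (h x * S.act t f x - S.act t f x) ∂μ), ← e0,
      ← integral_sub (hi4.const_mul 2) hi3]
    refine integral_congr_ae (Eventually.of_forall fun x => ?_)
    simp only
    rw [hgf]
    ring
  have h1 := sq_integral_mul_sub_one_le hh (S.measurable_act t hg) (abs_act_le_one (S := S) t hg1)
  have h2 := hW.variance_act_le hA hρ hcurv hh hs t hg hg1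
  rw [← e] at h1
  nlinarith

theorem WeakPoincareApprox.tvDist_le {A : Subalgebra ℝ (E → ℝ)}
    (hA : S.IsDiffusionAlgebra A) {ρ : ℝ} (hρ : 0 ≤ ρ) (hcurv : S.CurvatureBoundedBelow ρ)
    {β : ℝ → ℝ} {h : E → ℝ} (hh : IsProbDensity μ h) (hW : S.WeakPoincareApprox β h)
    {s : ℝ} (hs : 0 < s) (t : ℝ≥0) :
    tvDist (S.law t (densityMeasure μ h)) μ ≤ 2 * √(curvRate ρ t (β s) + 4 * s) :=
  tvDist_le_two_mul_sqrt fun _ hB => hW.sq_law_sub_le hA hρ hcurv hh hs t hB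

theorem tvDist_law_le_two {h : E → ℝ} (hh : IsProbDensity μ h) (t : ℝ≥0) :
    tvDist (S.law t (densityMeasure μ h)) μ ≤ 2 := by
  have := isProbabilityMeasure_densityMeasure hh
  have : IsProbabilityMeasure (S.law t (densityMeasure μ h)) :=
    inferInstanceAs (IsProbabilityMeasure (S.P t ∘ₘ densityMeasure μ h))
  exact tvDist_le_two

end MarkovSemigroup

/-! ### The function `θ` and the explicit rates. -/

section Theta

theorem thetaWP_set_nonempty {β : ℝ → ℝ} (hβ : AntitoneOn β (Ioi 0)) (hβ0 : ∀ s, 0 < s → 0 ≤ β s)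
    {ρ u : ℝ} (hρ : 0 < ρ) (hu : 0 < u) : {s : ℝ | 0 < s ∧ β s / s ≤ 4 * u / ρ}.Nonempty := by
  have h1 := hβ0 1 one_pos
  have hx : 0 ≤ β 1 * ρ / (4 * u) := by positivity
  refine ⟨1 + β 1 * ρ / (4 * u), by positivity, ?_⟩
  have h2 : β (1 + β 1 * ρ / (4 * u)) ≤ β 1 :=
    hβ (mem_Ioi.2 one_pos) (mem_Ioi.2 (by positivity)) (by linarith)
  rw [div_le_iff₀ (by positivity)]
  have e : 4 * u / ρ * (1 + β 1 * ρ / (4 * u)) = 4 * u / ρ + β 1 := by field_simp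
  rw [e]
  have : 0 ≤ 4 * u / ρ := by positivity
  linarith

theorem thetaWP_bddBelow (β : ℝ → ℝ) (ρ u : ℝ) :
    BddBelow {s : ℝ | 0 < s ∧ β s / s ≤ 4 * u / ρ} := ⟨0, fun _ hs => hs.1.le⟩

theorem thetaWP_nonneg (β : ℝ → ℝ) (ρ u : ℝ) : 0 ≤ thetaWP β ρ u :=
  Real.sInf_nonneg fun _ hs => hs.1.le

theorem thetaWP_anti {β : ℝ → ℝ} (hβ : AntitoneOn β (Ioi 0)) (hβ0 : ∀ s, 0 < s → 0 ≤ β s)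
    {ρ u v : ℝ} (hρ : 0 < ρ) (hu : 0 < u) (huv : u ≤ v) : thetaWP β ρ v ≤ thetaWP β ρ u :=
  csInf_le_csInf (thetaWP_bddBelow β ρ v) (thetaWP_set_nonempty hβ hβ0 hρ hu)
    fun _ hs => ⟨hs.1, hs.2.trans (by gcongr)⟩

/-- Arbitrarily small `r` satisfy `β(r) ≤ (4 u / ρ) r`, and `β(s) ≤ β(r)` for `r ≤ s`, so `β`
vanishes. -/
theorem eq_zero_of_thetaWP_eq_zero {β : ℝ → ℝ} (hβ : AntitoneOn β (Ioi 0))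
    (hβ0 : ∀ s, 0 < s → 0 ≤ β s) {ρ u : ℝ} (hρ : 0 < ρ) (hu : 0 < u) (h : thetaWP β ρ u = 0)
    {s : ℝ} (hs : 0 < s) : β s = 0 := by
  by_contra hne
  have hpos : 0 < β s := lt_of_le_of_ne (hβ0 s hs) (Ne.symm hne)
  have hx : 0 < min s (β s * ρ / (4 * u)) := lt_min hs (by positivity)
  obtain ⟨r, ⟨hr0, hr⟩, hrs⟩ := exists_lt_of_csInf_lt (thetaWP_set_nonempty hβ hβ0 hρ hu)
    (by rw [← thetaWP, h]; exact hx)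
  have h1 := hβ (mem_Ioi.2 hr0) (mem_Ioi.2 hs) (hrs.le.trans (min_le_left _ _))
  rw [div_le_iff₀ hr0] at hr
  have h2 : 4 * u / ρ * r < 4 * u / ρ * (β s * ρ / (4 * u)) := by
    gcongr
    exact hrs.trans_le (min_le_right _ _)
  have e : 4 * u / ρ * (β s * ρ / (4 * u)) = β s := by field_simp
  linarith

end Theta

namespace MarkovSemigroup

variable {E : Type*} [MeasurableSpace E] {μ : Measure E} [IsProbabilityMeasure μ]
  {S : MarkovSemigroup μ}

/-- For `e^{ρ t} ≥ 2`, every `s` admissible in `θ(e^{ρ t})` makes the rate at most `8 s`, so the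
squared distance is at most `4 (8 s + 4 s) = 48 s`. For smaller times the trivial bound `2` is
absorbed into the constant through `θ(2)`. -/
theorem WeakPoincareApprox.tvDist_le_thetaWP {A : Subalgebra ℝ (E → ℝ)}
    (hA : S.IsDiffusionAlgebra A) {ρ : ℝ} (hρ : 0 < ρ) (hcurv : S.CurvatureBoundedBelow ρ)
    {β : ℝ → ℝ} {h : E → ℝ} (hh : IsProbDensity μ h) (hW : S.WeakPoincareApprox β h) (t : ℝ≥0) :
    tvDist (S.law t (densityMeasure μ h)) μ ≤
      max (√48) (2 / √(thetaWP β ρ 2)) * √(thetaWP β ρ (Real.exp (ρ * t))) := by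
  have hβ := hW.antitoneOn
  have hβ0 := hW.nonneg
  set d := tvDist (S.law t (densityMeasure μ h)) μ
  have hu : 0 < Real.exp (ρ * t) := Real.exp_pos _
  rcases le_total 2 (Real.exp (ρ * t)) with h2 | h2
  · have key : d ≤ √48 * √(thetaWP β ρ (Real.exp (ρ * t))) := by
      rcases le_total d 0 with hd | hd
      · exact hd.trans (by positivity)
      rw [← Real.sqrt_mul (by norm_num)]
      refine Real.le_sqrt_of_sq_le ?_
      have : d ^ 2 / 48 ≤ thetaWP β ρ (Real.exp (ρ * t)) := by
        refine le_csInf (thetaWP_set_nonempty hβ hβ0 hρ hu) ?_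
        rintro s ⟨hs, hsu⟩
        have h3 : d ≤ _ := hW.tvDist_le hA hρ.le hcurv hh hs t
        have h4 := curvRate_le_of_two_le hρ (hβ0 s hs) h2
        have h5 : 2 * (ρ * β s) / Real.exp (ρ * t) ≤ 8 * s := by
          rw [div_le_iff₀ hs, div_mul_eq_mul_div, le_div_iff₀ hρ] at hsu
          rw [div_le_iff₀ hu]
          nlinarith
        have h6 : d ≤ 2 * √(12 * s) := h3.trans (by gcongr; linarith)
        have h7 : d ^ 2 ≤ (2 * √(12 * s)) ^ 2 := by gcongr
        rw [mul_pow, Real.sq_sqrt (by positivity)] at h7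
        linarith
      linarith
    exact key.trans (by gcongr; exact le_max_left _ _)
  -- If `θ(2) = 0` then `β` vanishes and the distance is zero, so the default `2 / 0 = 0` in the
  -- constant does no harm.
  · rcases (thetaWP_nonneg β ρ 2).eq_or_lt with h0 | h0
    · have hd : d ≤ 0 := by
        by_contra! hd
        -- This `s` yields `d² ≤ d² / 2`, which is absurd for `d > 0`.
        have h3 : d ≤ _ := hW.tvDist_le hA hρ.le hcurv hh (s := d ^ 2 / 32) (by positivity) t
        rw [eq_zero_of_thetaWP_eq_zero hβ hβ0 hρ two_pos h0.symm (by positivity), curvRate_eq,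
          zero_div, zero_add] at h3
        have h7 : d ^ 2 ≤ (2 * √(4 * (d ^ 2 / 32))) ^ 2 := by gcongr
        rw [mul_pow, Real.sq_sqrt (by positivity)] at h7
        nlinarith [pow_pos hd 2]
      exact hd.trans (by positivity)
    · have h1 := thetaWP_anti hβ hβ0 hρ hu h2
      have hs2 : 0 < √(thetaWP β ρ 2) := Real.sqrt_pos.2 h0
      calc d ≤ 2 := tvDist_law_le_two hh t
        _ = 2 / √(thetaWP β ρ 2) * √(thetaWP β ρ 2) := by field_simp
        _ ≤ _ := by
          gcongr
          exact le_max_right _ _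

theorem WeakPoincareApprox.tvDist_le_exp {A : Subalgebra ℝ (E → ℝ)}
    (hA : S.IsDiffusionAlgebra A) {ρ : ℝ} (hρ : 0 ≤ ρ) (hcurv : S.CurvatureBoundedBelow ρ)
    {c q : ℝ} (hq : 0 ≤ q) {β : ℝ → ℝ} (hc : ∀ s, 0 < s → β s ≤ c * s ^ (-q))
    {h : E → ℝ} (hh : IsProbDensity μ h) (hW : S.WeakPoincareApprox β h) (t : ℝ≥0) :
    tvDist (S.law t (densityMeasure μ h)) μ ≤
      2 * √(2 * ρ * |c| + 4) * Real.exp (-(ρ * t) / (2 * (1 + q))) := by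
  have hq1 : 0 < 1 + q := by linarith
  have ht : 0 ≤ ρ * t := by positivity
  rcases le_total 2 (Real.exp (ρ * t)) with h2 | h2
  · have hρ' : 0 < ρ := by
      refine lt_of_le_of_ne hρ ?_
      rintro rfl
      rw [zero_mul, Real.exp_zero] at h2
      norm_num at h2
    -- This `s` balances the two terms: `s^{-q} e^{-ρ t} = s`.
    set s := Real.exp (-(ρ * t) / (1 + q)) with hs
    have hs0 : 0 < s := Real.exp_pos _
    refine (hW.tvDist_le hA hρ hcurv hh hs0 t).trans ?_
    have h4 := curvRate_le_of_two_le hρ' (hW.nonneg s hs0) h2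
    have h5 : β s ≤ |c| * s ^ (-q) := (hc s hs0).trans (by gcongr; exact le_abs_self c)
    have e1 : s ^ (-q) = s * Real.exp (ρ * t) := by
      rw [hs, ← Real.exp_mul, ← Real.exp_add]
      congr 1
      field_simp
      ring
    have h6 : 2 * (ρ * β s) / Real.exp (ρ * t) ≤ 2 * ρ * |c| * s := by
      rw [div_le_iff₀ (Real.exp_pos _)]
      rw [e1] at h5
      calc 2 * (ρ * β s) ≤ 2 * (ρ * (|c| * (s * Real.exp (ρ * t)))) := by gcongr
        _ = _ := by ring
    have e2 : √s = Real.exp (-(ρ * t) / (2 * (1 + q))) := by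
      rw [hs, ← Real.exp_half]
      congr 1
      field_simp
    rw [mul_assoc, ← e2, ← Real.sqrt_mul (by positivity)]
    gcongr
    linarith
  · refine (tvDist_law_le_two hh t).trans ?_
    have h4 : 2 ≤ √(2 * ρ * |c| + 4) := by
      refine Real.le_sqrt_of_sq_le ?_
      have : 0 ≤ 2 * ρ * |c| := by positivity
      linarith
    -- For `e^{ρ t} ≤ 2` the exponential is at least `1 / 2`, as `2 (1 + q) ≥ 1`, and its
    -- coefficient is at least `4`, so the trivial bound `2` is enough.
    have h5 : 1 / 2 ≤ Real.exp (-(ρ * t) / (2 * (1 + q))) := by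
      calc (1 / 2 : ℝ) ≤ Real.exp (-(ρ * t)) := by
            rw [Real.exp_neg, one_div]
            exact inv_anti₀ (Real.exp_pos _) h2
        _ ≤ _ := by
            rw [Real.exp_le_exp, le_div_iff₀ (by positivity)]
            nlinarith
    nlinarith

end MarkovSemigroup

end

theorem theorem5p3 {E : Type*} [MeasurableSpace E] (μ : Measure E) [IsProbabilityMeasure μ]
    (S : MarkovSemigroup μ) (A : Subalgebra ℝ (E → ℝ)) (hA : S.IsDiffusionAlgebra A)
    (ρ : ℝ) (hρ : 0 ≤ ρ) (hcurv : S.CurvatureBoundedBelow ρ) :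
    (∀ (β : ℝ → ℝ) (h : E → ℝ), IsProbDensity μ h → S.WeakPoincareApprox β h →
      ∀ t : ℝ≥0, tvDist (S.law t (densityMeasure μ h)) μ ≤
        2 * Real.sqrt (⨅ s : Ioi (0 : ℝ), (curvRate ρ t (β s) + 4 * (s : ℝ)))) ∧
    (0 < ρ → ∀ β : ℝ → ℝ, (∃ s₀ : ℝ, 0 < s₀ ∧ AntitoneOn (fun s => β s / s) (Ioo 0 s₀)) →
      ∃ C : ℝ, ∀ h : E → ℝ, IsProbDensity μ h → S.WeakPoincareApprox β h →
        ∀ t : ℝ≥0, tvDist (S.law t (densityMeasure μ h)) μ ≤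
          C * Real.sqrt (thetaWP β ρ (Real.exp (ρ * t)))) ∧
    (∀ c q : ℝ, 0 ≤ q → ∃ C : ℝ, ∀ β : ℝ → ℝ, (∀ s, 0 < s → β s ≤ c * s ^ (-q)) →
      ∀ h : E → ℝ, IsProbDensity μ h → S.WeakPoincareApprox β h →
        ∀ t : ℝ≥0, tvDist (S.law t (densityMeasure μ h)) μ ≤
          C * Real.exp (-(ρ * t) / (2 * (1 + q)))) := by
  refine ⟨fun β h hh hW t => ?_, fun hρ' β _ =>
    ⟨max (√48) (2 / √(thetaWP β ρ 2)), fun h hh hW t => ?_⟩,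
    fun c q hq => ⟨2 * √(2 * ρ * |c| + 4), fun β hβ h hh hW t => ?_⟩⟩
  · have : Nonempty (Ioi (0 : ℝ)) := ⟨⟨1, mem_Ioi.2 one_pos⟩⟩
    exact tvDist_le_two_mul_sqrt fun B hB => le_ciInf fun s =>
      hW.sq_law_sub_le hA hρ hcurv hh s.2 t hB
  · exact hW.tvDist_le_thetaWP hA hρ' hcurv hh t
  · exact hW.tvDist_le_exp hA hρ hcurv hq hβ hh t
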